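/- Let $k\in\mathbb N$ and $\alpha>0$ be fixed. A $k$-decision list over $n$ Boolean variables is a list $(K_1,v_1),\dots,(K_r,v_r)$, $r\ge 1$, where each $K_j$ is a conjunction of at most $k$ literals from $x_1,\bar x_1,\dots,x_n,\bar x_n$, $v_j\in\{0,1\}$, and $K_r$ is the empty conjunction (true); its value at $x\in\{0,1\}^n$ is $v_j$ for the least $j$ such that $K_j$ is true at $x$, and its size is the number of pairs plus the number of literals in it. A probability distribution $D$ on $\{0,1\}^n$ is $\alpha$-log-Lipschitz if $D(x)>0$ for all $x$ and $|\log D(x)-\log D(x')|\le\log\alpha$ whenever $x,x'$ are at Hamming distance $d_H(x,x')=1$. For $h,c:\{0,1\}^n\to\{0,1\}$, the exact-in-the-ball robust risk with budget $\rho$ is $\mathsf R_\rho(h,c)=\Pr_{x\sim D}[\exists z:\ d_H(x,z)\le\rho,\ h(z)\ne c(z)]$. Then the class of $k$-decision lists is efficiently $\log_2(n)$-robustly learnable under $\alpha$-log-Lipschitz distributions: there are a deterministic learning algorithm $\mathcal A$, a deterministic evaluation algorithm and polynomials $\mathrm{poly}$, $p$, $q$ (all depending only on $k$ and $\alpha$)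 such that 1. for all $n,m\in\mathbb N$, on any $m$ points of $\{0,1\}^n$ labelled by a $k$-decision list, $\mathcal A$, which is given only these labelled points, halts after at most $p(n,m)$ steps and outputs a representation of a hypothesis $h:\{0,1\}^n\to\{0,1\}$, from which the evaluation algorithm computes $h(x)$ in at most $q(n)$ steps for every $x\in\{0,1\}^n$; 2. for every $n\in\mathbb N$, every $k$-decision list $c$ over $n$ variables, every $\alpha$-log-Lipschitz distribution $D$ on $\{0,1\}^n$, all $\varepsilon,\delta>0$ and every $m\ge \mathrm{poly}(n,1/\varepsilon,1/\delta,\mathrm{size}(c))$, if $S$ consists of $m$ independent points drawn from $D$ and labelled by $c$, then the hypothesis $h$ output by $\mathcal A$ on $S$ satisfies $$\Pr_{S\sim D^m}\big[\mathsf R_{\lfloor\log_2 n\rfloor}(h,c)<\varepsilon\big]>1-\delta$$ (with $\lfloor\log_2 n\rfloor$ read as $0$ for $n=0$). Algorithms are programs of a fixed unit-cost language on binary trees, whose operations are the empty tree, the two projections, pairing, composition, branching on emptiness, and while loops. -/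

import Mathlib

namespace RobustLearning

/-! ### The model of computation

Data are binary trees built from an empty tree.  Programs are built from constant-time pointer
operations (empty tree, projections, allocation of one node, test for emptiness), composition,
branching and `while` loops; each operation costs one step.  A tree is handled through a pointer to
its root, so that no operation copies a tree and `k` steps allocate at most `k` nodes.  This is the
usual unit-cost language over trees, polynomially related to Turing machines. -/

/-- The data of the programming language. -/
inductive Data : Type
  | nil : Data
  | node : Data → Data → Data

/-- The left subtree (`nil` has the left subtree `nil`). -/
def Data.left : Data → Data
  | .nil => .nil
  | .node a _ => a

/-- The right subtree (`nil` has the right subtree `nil`). -/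
def Data.right : Data → Data
  | .nil => .nil
  | .node _ b => b

/-- Programs. Every program maps a tree to a tree, if it halts. -/
inductive Prog : Type
  | skip : Prog
  | nil : Prog
  | fst : Prog
  | snd : Prog
  | pair : Prog → Prog → Prog
  /-- `comp g f` runs `f` and then `g`. -/
  | comp : Prog → Prog → Prog
  /-- `cond b f g` runs `f` if `b` yields a nonempty tree, and `g` otherwise. -/
  | cond : Prog → Prog → Prog → Prog
  /-- `loop b f` replaces the current tree by the result of `f` as long as `b` yields a nonempty
  tree. -/
  | loop : Prog → Prog → Prog

/-- `p.Runs x y t`: on input `x`, the program `p` halts with output `y` after exactly `t` steps. -/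
inductive Prog.Runs : Prog → Data → Data → ℕ → Prop
  | skip (x : Data) : Prog.Runs .skip x x 1
  | nil (x : Data) : Prog.Runs .nil x .nil 1
  | fst (x : Data) : Prog.Runs .fst x x.left 1
  | snd (x : Data) : Prog.Runs .snd x x.right 1
  | pair {f g : Prog} {x y z : Data} {s t : ℕ} :
      Prog.Runs f x y s → Prog.Runs g x z t → Prog.Runs (.pair f g) x (.node y z) (s + t + 1)
  | comp {f g : Prog} {x y z : Data} {s t : ℕ} :
      Prog.Runs f x y s → Prog.Runs g y z t → Prog.Runs (.comp g f) x z (s + t + 1)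
  | cond_true {b f g : Prog} {x u v y : Data} {s t : ℕ} :
      Prog.Runs b x (.node u v) s → Prog.Runs f x y t → Prog.Runs (.cond b f g) x y (s + t + 1)
  | cond_false {b f g : Prog} {x y : Data} {s t : ℕ} :
      Prog.Runs b x .nil s → Prog.Runs g x y t → Prog.Runs (.cond b f g) x y (s + t + 1)
  | loop_done {b f : Prog} {x : Data} {s : ℕ} :
      Prog.Runs b x .nil s → Prog.Runs (.loop b f) x x (s + 1)
  | loop_step {b f : Prog} {x u v y z : Data} {r s t : ℕ} :
      Prog.Runs b x (.node u v) r → Prog.Runs f x y s → Prog.Runs (.loop b f) y z t →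
        Prog.Runs (.loop b f) x z (r + s + t + 1)

/-- Programs are deterministic: output and number of steps are determined by the input. -/
theorem Prog.Runs.unique {p : Prog} {x y y' : Data} {t t' : ℕ}
    (h : p.Runs x y t) (h' : p.Runs x y' t') : y = y' ∧ t = t' := by
  induction h generalizing y' t' with
  | skip x => cases h'; exact ⟨rfl, rfl⟩
  | nil x => cases h'; exact ⟨rfl, rfl⟩
  | fst x => cases h'; exact ⟨rfl, rfl⟩
  | snd x => cases h'; exact ⟨rfl, rfl⟩
  | pair _ _ ih₁ ih₂ =>
    cases h' with
    | pair a b => obtain ⟨rfl, rfl⟩ := ih₁ a; obtain ⟨rfl, rfl⟩ := ih₂ b; exact ⟨rfl, rfl⟩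
  | comp _ _ ih₁ ih₂ =>
    cases h' with
    | comp a b => obtain ⟨rfl, rfl⟩ := ih₁ a; obtain ⟨rfl, rfl⟩ := ih₂ b; exact ⟨rfl, rfl⟩
  | cond_true _ _ ih₁ ih₂ =>
    cases h' with
    | cond_true a b => obtain ⟨_, rfl⟩ := ih₁ a; obtain ⟨rfl, rfl⟩ := ih₂ b; exact ⟨rfl, rfl⟩
    | cond_false a b => exact absurd (ih₁ a).1 (by simp)
  | cond_false _ _ ih₁ ih₂ =>
    cases h' with
    | cond_true a b => exact absurd (ih₁ a).1 (by simp)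
    | cond_false a b => obtain ⟨_, rfl⟩ := ih₁ a; obtain ⟨rfl, rfl⟩ := ih₂ b; exact ⟨rfl, rfl⟩
  | loop_done _ ih₁ =>
    cases h' with
    | loop_done a => obtain ⟨_, rfl⟩ := ih₁ a; exact ⟨rfl, rfl⟩
    | loop_step a b c => exact absurd (ih₁ a).1 (by simp)
  | loop_step _ _ _ ih₁ ih₂ ih₃ =>
    cases h' with
    | loop_done a => exact absurd (ih₁ a).1 (by simp)
    | loop_step a b c =>
      obtain ⟨_, rfl⟩ := ih₁ a
      obtain ⟨rfl, rfl⟩ := ih₂ b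
      obtain ⟨rfl, rfl⟩ := ih₃ c
      exact ⟨rfl, rfl⟩

/-- On input `x`, the program `p` halts with output `y` after at most `T` steps. -/
def Prog.RunsWithin (p : Prog) (x y : Data) (T : ℕ) : Prop :=
  ∃ t ≤ T, p.Runs x y t

/-! ### Inputs and outputs -/

/-- The Boolean hypercube `{0,1}ⁿ`. -/
abbrev Cube (n : ℕ) : Type := Fin n → Bool

/-- A bit as a tree. -/
def encodeBool : Bool → Data
  | false => .nil
  | true => .node .nil .nil

/-- A list of trees as a tree. -/
def encodeList : List Data → Data
  | [] => .nil
  | a :: l => .node a (encodeList l)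

/-- A point of the hypercube as the list of its bits. -/
def encodeCube {n : ℕ} (x : Cube n) : Data :=
  encodeList (List.ofFn fun i => encodeBool (x i))

/-- A labelled sample as the list of its labelled points. -/
def encodeSample {n m : ℕ} (S : Fin m → Cube n × Bool) : Data :=
  encodeList (List.ofFn fun j => .node (encodeCube (S j).1) (encodeBool (S j).2))

/-! ### Concept classes, distributions and robust risk -/

/-- A concept class, given by the representations of its concepts: `Rep n` are those of the concepts
on `{0,1}ⁿ`. -/
structure ConceptClass where
  Rep : ℕ → Type
  eval : {n : ℕ} → Rep n → Cube n → Bool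
  size : {n : ℕ} → Rep n → ℕ

/-- The exact-in-the-ball robust risk
`Pr_{x ∼ D} (∃ z, d_H(x, z) ≤ ρ and h(z) ≠ c(z))`. -/
noncomputable def robustRisk {n : ℕ} (D : PMF (Cube n)) (ρ : ℕ) (h c : Cube n → Bool) : ℝ :=
  D.toMeasure.real {x | ∃ z : Cube n, hammingDist x z ≤ ρ ∧ h z ≠ c z}

/-- `α`-log-Lipschitz distributions on `{0,1}ⁿ`: all points have positive mass, and the logarithms
of the masses of any two neighbours differ by at most `log α`. -/
def IsLogLipschitz {n : ℕ} (α : ℝ) (D : PMF (Cube n)) : Prop :=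
  (∀ x, D x ≠ 0) ∧
    ∀ x x' : Cube n, hammingDist x x' = 1 →
      |Real.log (D x).toReal - Real.log (D x').toReal| ≤ Real.log α

/-! ### Robust learning -/

/-- The points `xs` with their labels under `c`. -/
def labelled {n m : ℕ} (c : Cube n → Bool) (xs : Fin m → Cube n) : Fin m → Cube n × Bool :=
  fun j => (xs j, c (xs j))

/-- On the labelled sample `S`, the learner `L` outputs, within `T` steps, a representation `r` of
the hypothesis `h`, from which the program `E` evaluates `h` at any point within `T'` steps. -/
def Outputs (L E : Prog) {n m : ℕ} (S : Fin m → Cube n × Bool) (h : Cube n → Bool)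
    (T T' : ℕ) : Prop :=
  ∃ r : Data, L.RunsWithin (encodeSample S) r T ∧
    ∀ x : Cube n, E.RunsWithin (.node r (encodeCube x)) (encodeBool (h x)) T'

/-- The algorithm `L`, whose hypotheses are evaluated by the program `E`, efficiently `ρ`-robustly
learns `C` with respect to the distribution class `𝒟`:
* on every sample of `m` points of `{0,1}ⁿ` labelled by a concept of `C`, it halts after a number of
  steps polynomial in `n` and `m`, with a hypothesis that is evaluated in time polynomial in `n`;
* whenever `m ≥ poly(n, 1/ε, 1/δ, size(c))`, the hypothesis has robust risk less than `ε` with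
  probability greater than `1 - δ` over a sample of `m` independent points drawn from `D`. -/
def EfficientlyRobustlyLearns (L E : Prog) (ρ : ℕ → ℕ) (C : ConceptClass)
    (𝒟 : (n : ℕ) → Set (PMF (Cube n))) : Prop :=
  ∃ (poly : MvPolynomial (Fin 4) ℝ) (time : MvPolynomial (Fin 2) ℕ) (evalTime : Polynomial ℕ)
    (A : (n m : ℕ) → (Fin m → Cube n × Bool) → Cube n → Bool),
    (∀ (n m : ℕ) (c : C.Rep n) (xs : Fin m → Cube n),
      Outputs L E (labelled (C.eval c) xs) (A n m (labelled (C.eval c) xs))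
        (MvPolynomial.eval ![n, m] time) (evalTime.eval n)) ∧
    ∀ (n : ℕ) (c : C.Rep n), ∀ D ∈ 𝒟 n, ∀ ε δ : ℝ, 0 < ε → 0 < δ →
      ∀ m : ℕ, MvPolynomial.eval ![(n : ℝ), 1 / ε, 1 / δ, (C.size c : ℝ)] poly ≤ (m : ℝ) →
        1 - δ < (MeasureTheory.Measure.pi fun _ : Fin m => D.toMeasure).real
          {xs | robustRisk D (ρ n) (A n m (labelled (C.eval c) xs)) (C.eval c) < ε}

/-- Some algorithm efficiently `ρ`-robustly learns `C` with respect to `𝒟`. -/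
def EfficientlyRobustlyLearnable (ρ : ℕ → ℕ) (C : ConceptClass)
    (𝒟 : (n : ℕ) → Set (PMF (Cube n))) : Prop :=
  ∃ L E : Prog, EfficientlyRobustlyLearns L E ρ C 𝒟

/-! ### Decision lists -/

/-- Conjunctions of at most `k` literals over `n` variables; the literal `(i, true)` is `xᵢ` and
`(i, false)` is its negation. -/
abbrev Term (k n : ℕ) : Type := {K : Finset (Fin n × Bool) // K.card ≤ k}

/-- The value of a conjunction; the empty conjunction is true. -/
def Term.eval {k n : ℕ} (K : Term k n) (x : Cube n) : Bool :=
  decide (∀ l ∈ K.1, x l.1 = l.2)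

/-- A `k`-decision list `(K₁, v₁), …, (K_r, v_r)`, where `K_r` is the empty conjunction. -/
structure DecisionList (k n : ℕ) where
  items : List (Term k n × Bool)
  items_ne : items ≠ []
  last_true : (items.getLast items_ne).1.1 = ∅

/-- The value `v_j` for the least `j` such that `K_j` is true. (There is such a `j`, since the last
conjunction is true.) -/
def DecisionList.eval {k n : ℕ} (f : DecisionList k n) (x : Cube n) : Bool :=
  ((f.items.find? fun p => Term.eval p.1 x).map Prod.snd).getD false

/-- The number of pairs plus the number of literals. -/
def DecisionList.size {k n : ℕ} (f : DecisionList k n) : ℕ :=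
  (f.items.map fun p => p.1.1.card + 1).sum

/-- The class `k`-DL. -/
def kDL (k : ℕ) : ConceptClass where
  Rep := DecisionList k
  eval := DecisionList.eval
  size := DecisionList.size

end RobustLearning

namespace RobustLearning

/-! ### Expansions of CNF formulas under log-Lipschitz weights -/

/-- A clause, given by its set of variables and the assignment to them that falsifies it. -/
abbrev Clause (n : ℕ) : Type := Finset (Fin n) × Cube n

/-- `z` and `y` agree on the coordinates in `V`. -/
def Agree {n : ℕ} (V : Finset (Fin n)) (y z : Cube n) : Prop := ∀ i ∈ V, z i = y i

/-- `z` satisfies every clause of `Φ`. -/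
def Sat {n : ℕ} (Φ : Finset (Clause n)) (z : Cube n) : Prop := ∀ C ∈ Φ, ¬ Agree C.1 C.2 z

/-- `g` does not depend on the coordinates in `V`. -/
def IndepOf {n : ℕ} {β : Type*} (V : Finset (Fin n)) (g : Cube n → β) : Prop :=
  ∀ i ∈ V, ∀ x b, g (Function.update x i b) = g x

/-- Nonnegative weights whose values at neighbours are within a factor `α`. -/
structure IsSmooth {n : ℕ} (α : ℝ) (w : Cube n → ℝ) : Prop where
  nonneg : ∀ x, 0 ≤ w x
  le_mul : ∀ x i, w x ≤ α * w (Function.update x i (!x i))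

/-- The weight of the set of points with property `P`. -/
noncomputable def weight {n : ℕ} (w : Cube n → ℝ) (P : Cube n → Prop) : ℝ :=
  open Classical in ∑ x, if P x then w x else 0

section

variable {n : ℕ} {α : ℝ} {w : Cube n → ℝ}

theorem weight_mono (hw : ∀ x, 0 ≤ w x) {P Q : Cube n → Prop} (h : ∀ x, P x → Q x) :
    weight w P ≤ weight w Q := by
  classical
  refine Finset.sum_le_sum fun x _ => ?_
  by_cases hP : P x
  · simp [hP, h x hP]
  · simp only [hP, if_false]
    split_ifs
    exacts [hw x, le_rfl]

theorem weight_nonneg (hw : ∀ x, 0 ≤ w x) (P : Cube n → Prop) : 0 ≤ weight w P :=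
  Finset.sum_nonneg fun x _ => by split_ifs; exacts [hw x, le_rfl]

theorem weight_exists_le (hw : ∀ x, 0 ≤ w x) {ι : Type*} (s : Finset ι) (P : ι → Cube n → Prop) :
    weight w (fun x => ∃ i ∈ s, P i x) ≤ ∑ i ∈ s, weight w (P i) := by
  classical
  unfold weight
  rw [Finset.sum_comm]
  refine Finset.sum_le_sum fun x _ => ?_
  have h0 : ∀ i ∈ s, 0 ≤ if P i x then w x else 0 := fun i _ => by
    split_ifs; exacts [hw x, le_rfl]
  split_ifs with h
  · obtain ⟨i, hi, hP⟩ := h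
    calc w x = if P i x then w x else 0 := by simp [hP]
      _ ≤ _ := Finset.single_le_sum h0 hi
  · exact Finset.sum_nonneg h0

theorem exists_of_weight_pos {P : Cube n → Prop} (h : 0 < weight w P) : ∃ x, P x := by
  classical
  by_contra! hP
  simp [weight, hP] at h

/-- Flipping coordinate `i` exchanges the two halves of the cube, preserves `g` and changes the
weight by a factor of at most `α`; so the half `x i ≠ b` contributes at most `α` times the other. -/
theorem IsSmooth.sum_le_single (hw : IsSmooth α w) (i : Fin n) (b : Bool)
    {g : Cube n → ℝ} (hg : ∀ x, 0 ≤ g x) (hi : ∀ x b, g (Function.update x i b) = g x) :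
    ∑ x, w x * g x ≤ (1 + α) * ∑ x, if x i = b then w x * g x else 0 := by
  have hinv : Function.Involutive fun x : Cube n => Function.update x i (!x i) := by
    intro x; simp
  have h1 : ∑ x, w x * g x
      = (∑ x, if x i = b then w x * g x else 0) + ∑ x, if x i = b then 0 else w x * g x := by
    rw [← Finset.sum_add_distrib]
    exact Finset.sum_congr rfl fun x _ => by split_ifs <;> simp
  have h2 : (∑ x, if x i = b then 0 else w x * g x)
      ≤ α * ∑ x, if x i = b then w x * g x else 0 := by
    rw [← Equiv.sum_comp hinv.toPerm (fun x => if x i = b then w x * g x else 0), Finset.mul_sum]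
    refine Finset.sum_le_sum fun x _ => ?_
    have hc : ((!x i) = b) ↔ ¬ x i = b := by cases x i <;> cases b <;> simp
    simp only [Function.Involutive.coe_toPerm, Function.update_self, hc, hi]
    split_ifs
    · simp
    · rw [← mul_assoc]
      exact mul_le_mul_of_nonneg_right (hw.le_mul x i) (hg x)
  rw [h1]
  linarith

/-- The coordinates of `V` are fixed one at a time, each at a cost of `1 + α`. In probabilistic
terms, any assignment to `V` has conditional probability at least `(1 + α) ^ (-|V|)`, whatever is
known about the other coordinates. -/
theorem IsSmooth.sum_le (hw : IsSmooth α w) (hα : 0 ≤ α) (V : Finset (Fin n)) (y : Cube n)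
    {g : Cube n → ℝ} (hg : ∀ x, 0 ≤ g x) (hV : IndepOf V g) :
    ∑ x, w x * g x
      ≤ (1 + α) ^ V.card * ∑ x, (open Classical in if Agree V y x then w x * g x else 0) := by
  classical
  induction V using Finset.induction_on with
  | empty => simp [Agree]
  | insert i V hiV ih =>
    refine (ih fun j hj => hV j (Finset.mem_insert_of_mem hj)).trans ?_
    rw [Finset.card_insert_of_notMem hiV, pow_succ, mul_assoc]
    refine mul_le_mul_of_nonneg_left ?_ (by positivity)
    -- The indicator of the coordinates fixed so far is absorbed into `g`; it does not involve `i`.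
    have key := hw.sum_le_single i (y i) (g := fun x => if Agree V y x then g x else 0)
      (fun x => by split_ifs; exacts [hg x, le_rfl]) (fun x b => by
        have : Agree V y (Function.update x i b) ↔ Agree V y x := by
          refine forall₂_congr fun j hj => ?_
          rw [Function.update_of_ne (by rintro rfl; exact hiV hj)]
        simp only [this, hV i (Finset.mem_insert_self _ _)])
    simp only [mul_ite, mul_zero] at key
    refine key.trans (le_of_eq ?_)
    congr 1
    refine Finset.sum_congr rfl fun x _ => ?_
    have : Agree (insert i V) y x ↔ x i = y i ∧ Agree V y x := by simp [Agree]
    by_cases h1 : x i = y i <;> by_cases h2 : Agree V y x <;> simp [this, h1, h2]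

/-- An exponential moment of the number of falsified clauses. Given the coordinates outside a
clause, it is falsified with probability at least `(1 + α) ^ (-k)`; since the variables are
disjoint, the factors multiply as if the clauses were independent. -/
theorem IsSmooth.sum_prod_le (hw : IsSmooth α w) (hα : 0 ≤ α) {k : ℕ} (F : Finset (Clause n))
    (hk : ∀ C ∈ F, C.1.card ≤ k)
    (hF : (F : Set (Clause n)).PairwiseDisjoint Prod.fst) :
    ∑ x, w x * ∏ C ∈ F, (open Classical in if Agree C.1 C.2 x then (1 / 2 : ℝ) else 1)
      ≤ (1 - ((1 + α) ^ k)⁻¹ / 2) ^ F.card * ∑ x, w x := by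
  classical
  have h1 : 1 ≤ (1 + α) ^ k := one_le_pow₀ (by linarith)
  have hη : ((1 + α) ^ k)⁻¹ ≤ 1 := inv_le_one_of_one_le₀ h1
  have hη0 : 0 < ((1 + α) ^ k)⁻¹ := by positivity
  induction F using Finset.induction_on with
  | empty => simp
  | insert C F hCF ih =>
    have ih := ih (fun D hD => hk D (Finset.mem_insert_of_mem hD))
      (hF.subset (by simp))
    set g : Cube n → ℝ := fun x => ∏ C ∈ F, if Agree C.1 C.2 x then (1 / 2 : ℝ) else 1 with hgdef
    have hg : ∀ x, 0 ≤ g x := fun x => Finset.prod_nonneg fun C _ => by split_ifs <;> norm_num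
    have hind : IndepOf C.1 g := by
      intro i hi x b
      refine Finset.prod_congr rfl fun D hD => ?_
      have hdis : Disjoint C.1 D.1 := hF (by simp) (by simp [hD]) (by rintro rfl; exact hCF hD)
      have : Agree D.1 D.2 (Function.update x i b) ↔ Agree D.1 D.2 x := by
        refine forall₂_congr fun j hj => ?_
        rw [Function.update_of_ne]
        rintro rfl
        exact Finset.disjoint_left.mp hdis hi hj
      simp only [this]
    have key := hw.sum_le hα C.1 C.2 hg hind
    set T := ∑ x, if Agree C.1 C.2 x then w x * g x else 0 with hT
    have hTnn : 0 ≤ T := Finset.sum_nonneg fun x _ => by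
      split_ifs; exacts [mul_nonneg (hw.nonneg x) (hg x), le_rfl]
    have hle : ∑ x, w x * g x ≤ (1 + α) ^ k * T :=
      key.trans (mul_le_mul_of_nonneg_right
        (pow_le_pow_right₀ (by linarith) (hk C (Finset.mem_insert_self _ _))) hTnn)
    have hle' : ((1 + α) ^ k)⁻¹ * ∑ x, w x * g x ≤ T := by
      rw [inv_mul_le_iff₀ (by positivity)]; exact hle
    have heq : ∑ x, w x * ∏ C ∈ insert C F, (if Agree C.1 C.2 x then (1 / 2 : ℝ) else 1)
        = ∑ x, w x * g x - T / 2 := by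
      rw [hT, Finset.sum_div, ← Finset.sum_sub_distrib]
      refine Finset.sum_congr rfl fun x _ => ?_
      rw [Finset.prod_insert hCF]
      change w x * (_ * g x) = _
      split_ifs <;> ring
    rw [heq, Finset.card_insert_of_notMem hCF, pow_succ]
    calc _ ≤ (1 - ((1 + α) ^ k)⁻¹ / 2) * ∑ x, w x * g x := by linarith
      _ ≤ (1 - ((1 + α) ^ k)⁻¹ / 2)
          * ((1 - ((1 + α) ^ k)⁻¹ / 2) ^ F.card * ∑ x, w x) :=
        mul_le_mul_of_nonneg_left ih (by linarith)
      _ = _ := by ring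

/-- A point close to a solution falsifies few clauses of a disjoint family. -/
theorem card_falsified_le {Φ F : Finset (Clause n)} (hFΦ : F ⊆ Φ)
    (hF : (F : Set (Clause n)).PairwiseDisjoint Prod.fst) {x z : Cube n} (hz : Sat Φ z) :
    (open Classical in (F.filter fun C => Agree C.1 C.2 x).card) ≤ hammingDist x z := by
  classical
  -- Each falsified clause contains a coordinate where `x` and `z` differ, and disjoint clauses do
  -- not share one.
  refine Finset.card_le_card_of_forall_subsingleton (fun C i => i ∈ C.1) ?_ ?_
  · intro C hC
    rw [Finset.mem_filter] at hC
    have := hz C (hFΦ hC.1)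
    unfold Agree at this
    push Not at this
    obtain ⟨i, hi, hne⟩ := this
    exact ⟨i, by simp [hC.2 i hi, hne.symm], hi⟩
  · rintro i - C ⟨hC, hi⟩ D ⟨hD, hi'⟩
    by_contra hne
    exact Finset.disjoint_left.mp
      (hF (Finset.mem_filter.mp hC).1 (Finset.mem_filter.mp hD).1 hne) hi hi'

/-- The alternative `C ∈ F` is needed for the empty clause, which is disjoint even from itself. -/
theorem exists_maximal_disjoint (Φ : Finset (Clause n)) :
    ∃ F ⊆ Φ, (F : Set (Clause n)).PairwiseDisjoint Prod.fst ∧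
      ∀ C ∈ Φ, C ∈ F ∨ ∃ D ∈ F, ¬ Disjoint C.1 D.1 := by
  classical
  obtain ⟨F, hF, hmax⟩ := Finset.exists_max_image
    (Φ.powerset.filter fun F : Finset (Clause n) =>
      (F : Set (Clause n)).PairwiseDisjoint Prod.fst) Finset.card
    ⟨∅, by simp⟩
  rw [Finset.mem_filter, Finset.mem_powerset] at hF
  refine ⟨F, hF.1, hF.2, fun C hC => ?_⟩
  by_contra! h
  have := hmax (insert C F) (by
    rw [Finset.mem_filter, Finset.mem_powerset]
    refine ⟨Finset.insert_subset hC hF.1, ?_⟩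
    rw [Finset.coe_insert]
    exact hF.2.insert fun D hD _ => h.2 D hD)
  rw [Finset.card_insert_of_notMem h.1] at this
  omega

/-! ### Restriction of a formula by a partial assignment, and the induction on the width -/

/-- The formula left of `Φ` when the coordinates in `V` are fixed as in `y`. -/
noncomputable def restrict (Φ : Finset (Clause n)) (V : Finset (Fin n)) (y : Cube n) :
    Finset (Clause n) :=
  open Classical in
    (Φ.filter fun C => Agree (C.1 ∩ V) C.2 y).image fun C => (C.1 \ V, C.2)

theorem sat_restrict_iff {Φ : Finset (Clause n)} {V : Finset (Fin n)} {y z : Cube n}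
    (h : Agree V y z) : Sat (restrict Φ V y) z ↔ Sat Φ z := by
  classical
  unfold Sat restrict
  rw [Finset.forall_mem_image]
  simp only [Finset.mem_filter, and_imp]
  refine forall₂_congr fun C _ => ?_
  constructor
  · intro hC hag
    exact hC (fun i hi => by
      rw [Finset.mem_inter] at hi
      rw [← hag i hi.1, h i hi.2]) fun i hi => hag i (Finset.mem_sdiff.mp hi).1
  · intro hC h1 h2
    refine hC fun i hi => ?_
    by_cases hiV : i ∈ V
    · rw [h i hiV]; exact h1 i (Finset.mem_inter.mpr ⟨hi, hiV⟩)
    · exact h2 i (Finset.mem_sdiff.mpr ⟨hi, hiV⟩)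

/-- The variables in `V` have been deleted from all clauses. This independence lets
`IsSmooth.sum_le` compare all solutions of the restricted formula with those that agree with `y` on
`V`. -/
theorem indepOf_sat_restrict (Φ : Finset (Clause n)) (V : Finset (Fin n)) (y : Cube n) :
    IndepOf V fun z => Sat (restrict Φ V y) z := by
  classical
  intro i hi x b
  unfold Sat restrict
  simp only [Finset.forall_mem_image]
  refine propext (forall₂_congr fun C _ => not_congr (forall₂_congr fun j hj => ?_))
  rw [Function.update_of_ne]
  rintro rfl
  exact (Finset.mem_sdiff.mp hj).2 hi

/-- Markov's inequality for the moment in `IsSmooth.sum_prod_le`: a point within `L` of a solution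
falsifies at most `L` clauses of `F`, so its product is at least `2 ^ (-L)`. -/
theorem IsSmooth.weight_near_sat_le (hw : IsSmooth α w) (hα : 0 ≤ α) (hsum : ∑ x, w x = 1) {k : ℕ}
    {Φ F : Finset (Clause n)} (hFΦ : F ⊆ Φ) (hk : ∀ C ∈ Φ, C.1.card ≤ k)
    (hF : (F : Set (Clause n)).PairwiseDisjoint Prod.fst) (L : ℕ) :
    weight w (fun x => ∃ z, hammingDist x z ≤ L ∧ Sat Φ z)
      ≤ 2 ^ L * (1 - ((1 + α) ^ k)⁻¹ / 2) ^ F.card := by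
  classical
  have h := hw.sum_prod_le hα F (fun C hC => hk C (hFΦ hC)) hF
  rw [hsum, mul_one] at h
  refine le_trans ?_ (mul_le_mul_of_nonneg_left h (by positivity))
  rw [Finset.mul_sum]
  refine Finset.sum_le_sum fun x _ => ?_
  have hprod : ∏ C ∈ F, (if Agree C.1 C.2 x then (1 / 2 : ℝ) else 1)
      = (1 / 2) ^ (F.filter fun C => Agree C.1 C.2 x).card := by
    rw [Finset.prod_ite]; simp
  rw [hprod]
  have hwx := hw.nonneg x
  split_ifs with hx
  · obtain ⟨z, hz, hs⟩ := hx
    have hc : (F.filter fun C => Agree C.1 C.2 x).card ≤ L :=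
      le_trans (by convert card_falsified_le hFΦ hF hs) hz
    calc w x = 2 ^ L * (w x * (1 / 2) ^ L) := by
          rw [one_div, inv_pow]; field_simp
      _ ≤ _ := by
          gcongr 2 ^ L * (w x * ?_)
          exact pow_le_pow_of_le_one (by norm_num) (by norm_num) hc
  · positivity

/-- If the points within distance `L` of the solutions of a `k`-CNF formula have weight more than
`2 ^ (-L)`, then the solutions themselves have weight at least `2 ^ (-C * L)`. -/
theorem exists_weight_sat_ge (α : ℝ) (hα : 1 ≤ α) (k : ℕ) :
    ∃ C : ℕ, ∀ (n : ℕ) (w : Cube n → ℝ), IsSmooth α w → ∑ x, w x = 1 →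
      ∀ Φ : Finset (Clause n), (∀ K ∈ Φ, K.1.card ≤ k) → ∀ L : ℕ,
        (1 / 2 : ℝ) ^ L < weight w (fun x => ∃ z, hammingDist x z ≤ L ∧ Sat Φ z) →
        (1 / 2 : ℝ) ^ (C * L) ≤ weight w (Sat Φ) := by
  have hα0 : 0 ≤ α := by linarith
  induction k with
  | zero =>
    -- All clauses are empty, so one solution forces the formula to have no clauses and every point
    -- solves it.
    refine ⟨0, fun n w hw hsum Φ hΦ L hL => ?_⟩
    obtain ⟨x, z, -, hz⟩ := exists_of_weight_pos (lt_trans (by positivity) hL)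
    have hall : ∀ x, Sat Φ x := by
      intro x K hK
      have : K.1 = ∅ := Finset.card_eq_zero.mp (Nat.le_zero.mp (hΦ K hK))
      exact absurd (fun i hi => by simp [this] at hi) (hz K hK)
    simp [weight, hall, hsum]
  | succ k ih =>
    obtain ⟨C, hC⟩ := ih
    set θ : ℝ := 1 - ((1 + α) ^ (k + 1))⁻¹ / 2 with hθ
    have h1 : 1 ≤ (1 + α) ^ (k + 1) := one_le_pow₀ (by linarith)
    have hη : ((1 + α) ^ (k + 1))⁻¹ ≤ 1 := inv_le_one_of_one_le₀ h1
    have hη0 : 0 < ((1 + α) ^ (k + 1))⁻¹ := by positivity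
    have hθ0 : 0 ≤ θ := by linarith
    have hθ1 : θ < 1 := by linarith
    -- With `θ ^ A < 1 / 4`, a disjoint family of `A * L` clauses beats the factor `2 ^ L` and still
    -- leaves `2 ^ (-L)`.
    obtain ⟨A, hA⟩ := exists_pow_lt_of_lt_one (show (0 : ℝ) < 1 / 4 by norm_num) hθ1
    obtain ⟨B, hB⟩ := pow_unbounded_of_one_lt (1 + α) (one_lt_two)
    -- The first summand is the induction hypothesis at the larger radius `L'`; the second is the
    -- price `(1 + α) ^ |V|` of fixing `V`, with `1 + α < 2 ^ B`.
    refine ⟨C * (1 + (k + 1) * A) + B * ((k + 1) * A), fun n w hw hsum Φ hΦ L hL => ?_⟩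
    classical
    obtain ⟨F, hFΦ, hF, hmax⟩ := exists_maximal_disjoint Φ
    have hcard : F.card < A * L := by
      by_contra! hge
      have := hw.weight_near_sat_le hα0 hsum hFΦ hΦ hF L
      have h2 : θ ^ F.card ≤ (1 / 4) ^ L :=
        calc θ ^ F.card ≤ θ ^ (A * L) := pow_le_pow_of_le_one hθ0 hθ1.le hge
          _ = (θ ^ A) ^ L := pow_mul _ _ _
          _ ≤ _ := pow_le_pow_left₀ (by positivity) hA.le _
      have h3 : (2 : ℝ) ^ L * θ ^ F.card ≤ (1 / 2) ^ L :=
        calc (2 : ℝ) ^ L * θ ^ F.card ≤ 2 ^ L * (1 / 4) ^ L := by gcongr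
          _ = (1 / 2) ^ L := by rw [← mul_pow]; norm_num
      linarith
    set V : Finset (Fin n) := F.biUnion Prod.fst with hV
    have hVcard : V.card ≤ (k + 1) * A * L :=
      calc V.card ≤ F.card * (k + 1) :=
            Finset.card_biUnion_le_card_mul _ _ _ fun K hK => hΦ K (hFΦ hK)
        _ ≤ A * L * (k + 1) := Nat.mul_le_mul_right _ hcard.le
        _ = _ := by ring
    -- `L'` exceeds `L` by the bound for `V.card`, so that `2 ^ |V|` terms of size `2 ^ (-L')` sum
    -- to at most `2 ^ (-L)`.
    set L' := L * (1 + (k + 1) * A) with hL'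
    have hLL' : L + (k + 1) * A * L = L' := by rw [hL']; ring
    -- An assignment to `V` is coded by the subset of `V` where it is true.
    let pat : Finset (Fin n) → Cube n := fun U i => decide (i ∈ U)
    have hex : ∃ U ∈ V.powerset, (1 / 2 : ℝ) ^ L'
        < weight w (fun x => ∃ z, hammingDist x z ≤ L' ∧ Sat (restrict Φ V (pat U)) z) := by
      by_contra! hno
      refine absurd hL (not_lt.mpr ?_)
      calc weight w (fun x => ∃ z, hammingDist x z ≤ L ∧ Sat Φ z)
          ≤ weight w (fun x => ∃ U ∈ V.powerset,
              ∃ z, hammingDist x z ≤ L' ∧ Sat (restrict Φ V (pat U)) z) := by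
            refine weight_mono hw.nonneg ?_
            rintro x ⟨z, hz, hs⟩
            refine ⟨V.filter fun i => z i = true, by simp, z, by omega, ?_⟩
            rw [sat_restrict_iff]
            · exact hs
            · intro i hi
              simp [pat, hi]
        _ ≤ ∑ U ∈ V.powerset, (1 / 2 : ℝ) ^ L' :=
            (weight_exists_le hw.nonneg _ _).trans (Finset.sum_le_sum hno)
        _ = 2 ^ V.card * (1 / 2) ^ L' := by simp
        _ ≤ 2 ^ ((k + 1) * A * L) * (1 / 2) ^ L' := by
            gcongr
            norm_num
        _ = (1 / 2) ^ L := by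
            rw [← hLL', pow_add, mul_left_comm, ← mul_pow]; norm_num
    obtain ⟨U, -, hU⟩ := hex
    set Ψ := restrict Φ V (pat U) with hΨ
    have hΨk : ∀ K ∈ Ψ, K.1.card ≤ k := by
      intro K hK
      simp only [hΨ, restrict, Finset.mem_image, Finset.mem_filter] at hK
      obtain ⟨K, ⟨hK, -⟩, rfl⟩ := hK
      have hK1 := hΦ K hK
      change (K.1 \ V).card ≤ k
      rcases Finset.eq_empty_or_nonempty K.1 with h0 | ⟨j, hj⟩
      · simp [h0]
      -- Maximality of `F` makes every nonempty clause lose a variable.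
      have hmeet : ∃ i ∈ K.1, i ∈ V := by
        rcases hmax K hK with hKF | ⟨D, hD, hKD⟩
        · exact ⟨j, hj, Finset.mem_biUnion.mpr ⟨K, hKF, hj⟩⟩
        · obtain ⟨i, hi, hi'⟩ := Finset.not_disjoint_iff.mp hKD
          exact ⟨i, hi, Finset.mem_biUnion.mpr ⟨D, hD, hi'⟩⟩
      obtain ⟨i, hi, hiV⟩ := hmeet
      have : (K.1 \ V).card < K.1.card :=
        Finset.card_lt_card ⟨Finset.sdiff_subset, fun h => (Finset.mem_sdiff.mp (h hi)).2 hiV⟩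
      omega
    have h4 := hC n w hw hsum Ψ hΨk L' hU
    have h5 : weight w (Sat Ψ) ≤ (1 + α) ^ V.card * weight w (Sat Φ) := by
      have h6 := hw.sum_le hα0 V (pat U) (g := fun x => if Sat Ψ x then 1 else 0)
        (fun x => by split_ifs <;> norm_num) (fun i hi x b => by
          have := indepOf_sat_restrict Φ V (pat U) i hi x b
          simp only [← hΨ] at this
          simp only [this])
      calc weight w (Sat Ψ) = ∑ x, w x * if Sat Ψ x then 1 else 0 := by simp [weight]
        _ ≤ _ := h6
        _ ≤ _ := by
          refine mul_le_mul_of_nonneg_left (Finset.sum_le_sum fun x _ => ?_) (by positivity)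
          by_cases hag : Agree V (pat U) x
          · simp [hag, hΨ, sat_restrict_iff hag]
          · simp only [hag, if_false]
            split_ifs
            exacts [hw.nonneg x, le_rfl]
    have h7 : (1 + α) ^ V.card ≤ 2 ^ (B * ((k + 1) * A) * L) :=
      calc (1 + α) ^ V.card ≤ (1 + α) ^ ((k + 1) * A * L) :=
            pow_le_pow_right₀ (by linarith) hVcard
        _ ≤ (2 ^ B) ^ ((k + 1) * A * L) := pow_le_pow_left₀ (by linarith) hB.le _
        _ = _ := by rw [← pow_mul]; ring_nf
    have h8 := h4.trans (h5.trans (mul_le_mul_of_nonneg_right h7 (weight_nonneg hw.nonneg _)))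
    calc (1 / 2 : ℝ) ^ ((C * (1 + (k + 1) * A) + B * ((k + 1) * A)) * L)
        = (1 / 2) ^ (B * ((k + 1) * A) * L) * (1 / 2) ^ (C * L') := by
          rw [← pow_add, hL']; ring_nf
      _ ≤ (1 / 2) ^ (B * ((k + 1) * A) * L)
          * (2 ^ (B * ((k + 1) * A) * L) * weight w (Sat Φ)) := by gcongr
      _ = weight w (Sat Φ) := by
          rw [← mul_assoc, ← mul_pow]; norm_num

end

/-! ### First-match lists of terms -/

section

variable {n k : ℕ} {α : ℝ}

theorem sat_union {Φ Ψ : Finset (Clause n)} {z : Cube n} :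
    Sat (open Classical in Φ ∪ Ψ) z ↔ Sat Φ z ∧ Sat Ψ z := by
  classical
  unfold Sat
  constructor
  · intro h
    exact ⟨fun C hC => h C (Finset.mem_union_left _ hC),
      fun C hC => h C (Finset.mem_union_right _ hC)⟩
  · rintro ⟨h1, h2⟩ C hC
    rcases Finset.mem_union.mp hC with hC | hC
    exacts [h1 C hC, h2 C hC]

/-- One unit clause for each literal, falsified by the opposite value. -/
theorem Term.exists_cnf (K : Term k n) :
    ∃ Φ : Finset (Clause n), (∀ C ∈ Φ, C.1.card ≤ 1) ∧ ∀ x, Sat Φ x ↔ K.eval x = true := by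
  classical
  refine ⟨K.1.image fun l => ({l.1}, fun _ => !l.2), ?_, fun x => ?_⟩
  · rw [Finset.forall_mem_image]
    simp
  · unfold Sat Term.eval
    rw [Finset.forall_mem_image, decide_eq_true_iff]
    refine forall₂_congr fun l _ => ?_
    simp [Agree]

/-- The negation of a conjunction is a single clause. A contradictory conjunction is treated apart:
its negation is always true, and the assignment stored in a clause cannot give two values to one
variable. -/
theorem Term.exists_cnf_not (K : Term k n) :
    ∃ Φ : Finset (Clause n), (∀ C ∈ Φ, C.1.card ≤ k) ∧ ∀ x, Sat Φ x ↔ K.eval x = false := by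
  classical
  by_cases hK : ∃ i, (i, true) ∈ K.1 ∧ (i, false) ∈ K.1
  · obtain ⟨i, h1, h2⟩ := hK
    refine ⟨∅, by simp, fun x => ?_⟩
    simp only [Sat, Term.eval, Finset.notMem_empty, false_imp_iff, implies_true, true_iff,
      decide_eq_false_iff_not]
    intro h
    have a := h _ h1
    have b := h _ h2
    simp_all
  · refine ⟨{(K.1.image Prod.fst, fun i => decide ((i, true) ∈ K.1))}, ?_, fun x => ?_⟩
    · simp only [Finset.mem_singleton, forall_eq]
      exact Finset.card_image_le.trans K.2
    · simp only [Sat, Term.eval, Finset.mem_singleton, forall_eq, decide_eq_false_iff_not, Agree,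
        Finset.forall_mem_image]
      refine not_congr (forall₂_congr fun l hl => ?_)
      obtain ⟨i, b⟩ := l
      cases b with
      | true => simp [hl]
      | false =>
        have : (i, true) ∉ K.1 := fun h => hK ⟨i, h, hl⟩
        simp [this]

/-- The label of the first test passed by `x`, and `false` if there is none. -/
def firstMatch {X : Type*} (I : List ((X → Bool) × Bool)) (x : X) : Bool :=
  ((I.find? fun p => p.1 x).map Prod.snd).getD false

/-- The hypercube is covered by the solutions of at most `r` many `k`-CNF formulas, on each of which
`f` is constant. -/
def HasCells (k r : ℕ) (f : Cube n → Bool) : Prop :=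
  ∃ Cs : List (Finset (Clause n) × Bool), Cs.length ≤ r ∧
    (∀ p ∈ Cs, ∀ C ∈ p.1, C.1.card ≤ k) ∧ (∀ x, ∃ p ∈ Cs, Sat p.1 x) ∧
    ∀ p ∈ Cs, ∀ x, Sat p.1 x → f x = p.2

/-- A cell says that one test holds and all earlier ones fail; the extra cell, where all fail,
carries the default `false`. The width `k + 1` bounds both the unit clauses and the negated terms,
including the case `k = 0`. -/
theorem hasCells_firstMatch (I : List ((Cube n → Bool) × Bool))
    (hI : ∀ p ∈ I, ∃ K : Term k n, p.1 = K.eval) :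
    HasCells (k + 1) (I.length + 1) (firstMatch I) := by
  classical
  induction I with
  | nil => exact ⟨[(∅, false)], by simp, by simp, by simp [Sat], by simp [firstMatch]⟩
  | cons q I ih =>
    obtain ⟨f, v⟩ := q
    obtain ⟨Cs, hlen, hk, hcov, hval⟩ := ih fun p hp => hI p (List.mem_cons_of_mem _ hp)
    obtain ⟨K, hK⟩ := hI (f, v) List.mem_cons_self
    obtain ⟨Φ, hΦk, hΦ⟩ := K.exists_cnf
    obtain ⟨Ψ, hΨk, hΨ⟩ := K.exists_cnf_not
    simp only at hK
    subst hK
    refine ⟨(Φ, v) :: Cs.map fun p => (Ψ ∪ p.1, p.2), by simpa using hlen, ?_, fun x => ?_, ?_⟩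
    · simp only [List.mem_cons, List.mem_map]
      rintro p (rfl | ⟨p, hp, rfl⟩) C hC
      · exact (hΦk C hC).trans (by omega)
      · rcases Finset.mem_union.mp hC with hC | hC
        exacts [(hΨk C hC).trans (by omega), hk p hp C hC]
    · cases hx : K.eval x with
      | true => exact ⟨_, List.mem_cons_self, (hΦ x).mpr hx⟩
      | false =>
        obtain ⟨p, hp, hs⟩ := hcov x
        exact ⟨_, List.mem_cons_of_mem _ (List.mem_map_of_mem hp),
          sat_union.mpr ⟨(hΨ x).mpr hx, hs⟩⟩
    · simp only [List.mem_cons, List.mem_map]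
      rintro p (rfl | ⟨p, hp, rfl⟩) x hx
      · simp [firstMatch, (hΦ x).mp hx]
      · obtain ⟨h1, h2⟩ := sat_union.mp hx
        rw [← hval p hp x h2]
        simp [firstMatch, (hΨ x).mp h1]

theorem DecisionList.eval_eq_firstMatch (c : DecisionList k n) :
    c.eval = firstMatch (c.items.map fun p => (p.1.eval, p.2)) := by
  funext x
  unfold DecisionList.eval firstMatch
  rw [List.find?_map]
  simp [Function.comp_def]

theorem DecisionList.length_le_size (c : DecisionList k n) : c.items.length ≤ c.size := by
  unfold DecisionList.size
  calc c.items.length = (c.items.map fun _ => 1).sum := by simp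
    _ ≤ _ := List.sum_le_sum fun p _ => by omega

theorem DecisionList.hasCells (c : DecisionList k n) : HasCells (k + 1) (c.size + 1) c.eval := by
  rw [c.eval_eq_firstMatch]
  obtain ⟨Cs, h, h'⟩ := hasCells_firstMatch (k := k) (c.items.map fun p => (p.1.eval, p.2)) (by
    simp only [List.mem_map]
    rintro _ ⟨p, -, rfl⟩
    exact ⟨p.1, rfl⟩)
  have := c.length_le_size
  rw [List.length_map] at h
  exact ⟨Cs, by omega, h'⟩

/-! ### Risk -/

theorem measureReal_eq_weight (D : PMF (Cube n)) (P : Cube n → Prop) :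
    D.toMeasure.real {x | P x} = weight (fun x => (D x).toReal) P := by
  classical
  unfold weight MeasureTheory.Measure.real
  rw [PMF.toMeasure_apply_fintype, ENNReal.toReal_sum]
  · refine Finset.sum_congr rfl fun x _ => ?_
    by_cases h : P x <;> simp [h]
  · intro x _
    by_cases h : P x <;> simp [h, D.apply_ne_top]

/-- The factor is `max α 1` because `exists_weight_sat_ge` asks for at least `1`. For `α < 1` the
hypothesis forbids neighbours altogether, so only `n = 0` is left. -/
theorem IsLogLipschitz.isSmooth (hα : 0 < α) {D : PMF (Cube n)} (hD : IsLogLipschitz α D) :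
    IsSmooth (max α 1) fun x => (D x).toReal := by
  have hpos : ∀ x, 0 < (D x).toReal := fun x => ENNReal.toReal_pos (hD.1 x) (D.apply_ne_top x)
  refine ⟨fun x => (hpos x).le, fun x i => ?_⟩
  set x' := Function.update x i (!x i) with hx'
  have hdist : hammingDist x x' = 1 := by
    unfold hammingDist
    rw [Finset.card_eq_one]
    refine ⟨i, ?_⟩
    ext j
    by_cases hj : j = i
    · subst hj; simp [hx']
    · simp [hx', hj]
  have h := (abs_le.mp (hD.2 x x' hdist)).2
  have h2 : Real.log (D x).toReal ≤ Real.log (α * (D x').toReal) := by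
    rw [Real.log_mul hα.ne' (hpos x').ne']; linarith
  rw [Real.log_le_log_iff (hpos x) (mul_pos hα (hpos x'))] at h2
  exact h2.trans (mul_le_mul_of_nonneg_right (le_max_left _ _) (hpos x').le)

theorem sum_toReal_eq_one (D : PMF (Cube n)) : ∑ x, (D x).toReal = 1 := by
  rw [← ENNReal.toReal_sum fun x _ => D.apply_ne_top x, ← tsum_fintype (L := .unconditional _),
    D.tsum_coe, ENNReal.toReal_one]

/-- Functions with few cells and a large robust risk disagree on a set of large probability. -/
theorem exists_weight_ne_ge (α : ℝ) (hα : 0 < α) (k : ℕ) :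
    ∃ C : ℕ, ∀ (n : ℕ) (D : PMF (Cube n)), IsLogLipschitz α D → ∀ (f g : Cube n → Bool) (a b : ℕ),
      HasCells k a f → HasCells k b g → ∀ (L ρ : ℕ) (ε : ℝ), ρ ≤ L →
        (a * b : ℝ) * (1 / 2) ^ L < ε → ε ≤ robustRisk D ρ f g →
        (1 / 2 : ℝ) ^ (C * L) ≤ weight (fun x => (D x).toReal) fun x => f x ≠ g x := by
  classical
  obtain ⟨C, hC⟩ := exists_weight_sat_ge (max α 1) (le_max_right _ _) k
  refine ⟨C, fun n D hD f g a b hf hg L ρ ε hρ hL hε => ?_⟩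
  obtain ⟨Cs, hCa, hCk, hCcov, hCval⟩ := hf
  obtain ⟨Ds, hDa, hDk, hDcov, hDval⟩ := hg
  have hw := hD.isSmooth hα
  set w := fun x => (D x).toReal with hwdef
  set s := (Cs.toFinset ×ˢ Ds.toFinset).filter fun p => p.1.2 ≠ p.2.2 with hs
  by_contra hlt
  refine absurd (hL.trans_le hε) (not_lt.mpr ?_)
  -- A pair of cells violating this bound would have an intersection of weight at least `2 ^ (-C *
  -- L)`, and `f ≠ g` throughout that intersection.
  have hbound : ∀ p ∈ s, weight w (fun x => ∃ z, hammingDist x z ≤ L ∧ Sat (p.1.1 ∪ p.2.1) z)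
      ≤ (1 / 2) ^ L := by
    rintro ⟨p, q⟩ hpq
    simp only [hs, Finset.mem_filter, Finset.mem_product, List.mem_toFinset] at hpq
    obtain ⟨⟨hp, hq⟩, hne⟩ := hpq
    by_contra! hgt
    refine hlt ((hC n w hw (sum_toReal_eq_one D) (p.1 ∪ q.1) ?_ L hgt).trans
      (weight_mono hw.nonneg fun x hx => ?_))
    · intro K hK
      rcases Finset.mem_union.mp hK with hK | hK
      exacts [hCk p hp K hK, hDk q hq K hK]
    · obtain ⟨h1, h2⟩ := sat_union.mp hx
      rwa [hCval p hp x h1, hDval q hq x h2]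
  unfold robustRisk
  rw [measureReal_eq_weight]
  calc weight w (fun x => ∃ z, hammingDist x z ≤ ρ ∧ f z ≠ g z)
      ≤ weight w (fun x => ∃ p ∈ s, ∃ z, hammingDist x z ≤ L ∧ Sat (p.1.1 ∪ p.2.1) z) := by
        refine weight_mono hw.nonneg ?_
        rintro x ⟨z, hz, hne⟩
        obtain ⟨p, hp, hps⟩ := hCcov z
        obtain ⟨q, hq, hqs⟩ := hDcov z
        refine ⟨(p, q), ?_, z, hz.trans hρ, sat_union.mpr ⟨hps, hqs⟩⟩
        simp only [hs, Finset.mem_filter, Finset.mem_product, List.mem_toFinset]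
        exact ⟨⟨hp, hq⟩, by rwa [← hCval p hp z hps, ← hDval q hq z hqs]⟩
    _ ≤ ∑ p ∈ s, (1 / 2 : ℝ) ^ L :=
        (weight_exists_le hw.nonneg _ _).trans (Finset.sum_le_sum hbound)
    _ = s.card * (1 / 2 : ℝ) ^ L := by simp
    _ ≤ (a * b : ℝ) * (1 / 2) ^ L := by
        have h1 : s.card ≤ a * b :=
          (Finset.card_filter_le _ _).trans (by
            rw [Finset.card_product]
            exact Nat.mul_le_mul (Cs.toFinset_card_le.trans hCa) (Ds.toFinset_card_le.trans hDa))
        gcongr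
        exact_mod_cast h1

/-! ### Sample bounds -/

/-- `L` is `log₂ Q` rounded up. It has to dominate the radius `log₂ n` and make `2 ^ (-L)` small,
while `2 ^ (C * L)` stays polynomial in `Q`. -/
theorem exists_log_le {Q : ℝ} (hQ : 1 ≤ Q) {n : ℕ} (hn : n ≤ Q) :
    ∃ L : ℕ, Nat.log 2 n ≤ L ∧ Q ≤ 2 ^ L ∧ (2 : ℝ) ^ L ≤ 2 * (Q + 1) := by
  refine ⟨Nat.clog 2 ⌈Q⌉₊, ?_, ?_, ?_⟩
  · exact (Nat.log_le_clog 2 n).trans (Nat.clog_mono_right 2 (by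
      exact_mod_cast hn.trans (Nat.le_ceil Q)))
  · exact (Nat.le_ceil Q).trans (by exact_mod_cast Nat.le_pow_clog one_lt_two _)
  · have h1 : (⌈Q⌉₊ : ℝ) < Q + 1 := Nat.ceil_lt_add_one (by linarith)
    have h2 : 1 ≤ ⌈Q⌉₊ := Nat.one_le_ceil_iff.mpr (by linarith)
    rcases h2.eq_or_lt with h | h
    · rw [← h, Nat.clog_one_right, pow_zero]; linarith
    · have h3 := Nat.pow_pred_clog_lt_self one_lt_two h
      have h4 : 0 < Nat.clog 2 ⌈Q⌉₊ := Nat.clog_pos one_lt_two h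
      have h5 : (2 : ℝ) ^ (Nat.clog 2 ⌈Q⌉₊ - 1) < ⌈Q⌉₊ := by exact_mod_cast h3
      calc (2 : ℝ) ^ Nat.clog 2 ⌈Q⌉₊ = 2 * 2 ^ (Nat.clog 2 ⌈Q⌉₊ - 1) := by
            rw [← pow_succ']; congr 1; omega
        _ ≤ _ := by linarith

theorem pi_consistent_eq (D : PMF (Cube n)) (m : ℕ) (f c : Cube n → Bool) :
    (MeasureTheory.Measure.pi fun _ : Fin m => D.toMeasure).real
      {xs | ∀ j, f (xs j) = c (xs j)}
      = (1 - weight (fun x => (D x).toReal) fun x => f x ≠ c x) ^ m := by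
  have h1 : {xs : Fin m → Cube n | ∀ j, f (xs j) = c (xs j)}
      = Set.univ.pi fun _ => {x | f x ≠ c x}ᶜ := by
    ext; simp
  rw [h1, ← measureReal_eq_weight,
    ← MeasureTheory.probReal_compl_eq_one_sub (MeasurableSet.of_discrete)]
  simp [MeasureTheory.Measure.real, MeasureTheory.Measure.pi_pi]

/-- A learner whose hypotheses are sublists of a fixed list and consistent with the sample has small
robust risk with high probability. -/
theorem exists_sample_bound (α : ℝ) (hα : 0 < α) (k : ℕ) :
    ∃ C : ℕ, ∀ (n : ℕ) (c : DecisionList k n) (D : PMF (Cube n)), IsLogLipschitz α D →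
      ∀ (W : List ((Cube n → Bool) × Bool)), (∀ p ∈ W, ∃ K : Term k n, p.1 = K.eval) →
      ∀ (m : ℕ) (h : (Fin m → Cube n) → Cube n → Bool),
      (∀ xs, ∃ I, I.Sublist W ∧ h xs = firstMatch I ∧ ∀ j, h xs (xs j) = c.eval (xs j)) →
      ∀ ε δ : ℝ, 0 < ε → 0 < δ →
      (2 * ((n + 1) * ((W.length + 1) * (c.size + 1)) * (1 + 1 / ε) + 1)) ^ C
        * (W.length + 1 / δ) ≤ (m : ℝ) →
      1 - δ < (MeasureTheory.Measure.pi fun _ : Fin m => D.toMeasure).real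
          {xs | robustRisk D (Nat.log 2 n) (h xs) c.eval < ε} := by
  classical
  obtain ⟨C, hC⟩ := exists_weight_ne_ge α hα (k + 1)
  refine ⟨C, fun n c D hD W hW m h hh ε δ hε hδ hm => ?_⟩
  set P : ℝ := (W.length + 1) * (c.size + 1) with hP
  -- `P` bounds the number of pairs of cells. The factor `n + 1` gives `log₂ n ≤ L`; the factor `1 +
  -- 1 / ε` gives `P * 2 ^ (-L) < ε` strictly and keeps `Q ≥ 1` for large `ε`.
  set Q : ℝ := (n + 1) * P * (1 + 1 / ε) with hQ
  have hP1 : 1 ≤ P := by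
    rw [hP]; exact one_le_mul_of_one_le_of_one_le (by simp) (by simp)
  have hε1 : 0 < 1 / ε := by positivity
  have hPQ : (n + 1) * P ≤ Q := le_mul_of_one_le_right (by positivity) (by linarith)
  have hnP : (n + 1 : ℝ) ≤ (n + 1) * P := le_mul_of_one_le_right (by positivity) hP1
  have hn0 : (0 : ℝ) ≤ n := Nat.cast_nonneg n
  obtain ⟨L, hnL, hQL, hLQ⟩ := exists_log_le (Q := Q) (n := n) (by linarith) (by linarith)
  set η : ℝ := (1 / 2) ^ (C * L) with hη
  have hη0 : 0 < η := by positivity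
  have hPL : P * (1 / 2) ^ L < ε := by
    have h1 : P / ε < 2 ^ L := by
      refine lt_of_lt_of_le ?_ hQL
      calc P / ε = P * (1 / ε) := by ring
        _ < P * (1 + 1 / ε) := by gcongr; linarith
        _ ≤ Q := by
          have h2 : P ≤ (n + 1) * P := le_mul_of_one_le_left (by positivity) (by linarith)
          exact mul_le_mul_of_nonneg_right h2 (by positivity)
    rw [div_lt_iff₀ hε] at h1
    rw [one_div, inv_pow, ← div_eq_mul_inv, div_lt_iff₀ (by positivity)]
    linarith
  have hηm : W.length + 1 / δ ≤ η * m := by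
    have h1 : (2 : ℝ) ^ (C * L) ≤ (2 * (Q + 1)) ^ C := by
      rw [mul_comm, pow_mul]; exact pow_le_pow_left₀ (by positivity) hLQ _
    have h2 : (2 : ℝ) ^ (C * L) * (W.length + 1 / δ) ≤ m :=
      (mul_le_mul_of_nonneg_right h1 (by positivity)).trans hm
    calc (W.length + 1 / δ : ℝ) = η * (2 ^ (C * L) * (W.length + 1 / δ)) := by
          rw [hη, ← mul_assoc, ← mul_pow]; norm_num
      _ ≤ _ := by gcongr
  set μ := MeasureTheory.Measure.pi fun _ : Fin m => D.toMeasure with hμ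
  set S := {xs : Fin m → Cube n | robustRisk D (Nat.log 2 n) (h xs) c.eval < ε} with hS
  -- Union bound over the at most `2 ^ W.length` hypotheses that are robustly bad; each is
  -- consistent with the sample with probability at most `(1 - η) ^ m ≤ exp (-(η * m))`.
  set bad := W.sublists.toFinset.filter fun I =>
    ε ≤ robustRisk D (Nat.log 2 n) (firstMatch I) c.eval with hbad
  have hsub : Sᶜ ⊆ ⋃ I ∈ bad, {xs | ∀ j, firstMatch I (xs j) = c.eval (xs j)} := by
    intro xs hxs
    obtain ⟨I, hI, hfI, hcons⟩ := hh xs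
    simp only [hS, Set.mem_compl_iff, Set.mem_ofPred_eq, not_lt] at hxs
    simp only [Set.mem_iUnion, Set.mem_ofPred_eq]
    rw [hfI] at hxs hcons
    exact ⟨I, by simp [hbad, hI, hxs], hcons⟩
  have hone : ∀ I ∈ bad, μ.real {xs | ∀ j, firstMatch I (xs j) = c.eval (xs j)}
      ≤ Real.exp (-(η * m)) := by
    intro I hI
    simp only [hbad, Finset.mem_filter, List.mem_toFinset, List.mem_sublists] at hI
    have hcells : HasCells (k + 1) (W.length + 1) (firstMatch I) := by
      obtain ⟨Cs, h1, h2⟩ := hasCells_firstMatch I fun p hp => hW p (hI.1.subset hp)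
      exact ⟨Cs, h1.trans (Nat.succ_le_succ hI.1.length_le), h2⟩
    have h1 := hC n D hD _ _ _ _ hcells c.hasCells L _ ε hnL (by push_cast; exact hPL) hI.2
    have h2 : 0 ≤ 1 - weight (fun x => (D x).toReal) fun x => firstMatch I x ≠ c.eval x := by
      rw [← measureReal_eq_weight]
      linarith [MeasureTheory.measureReal_le_one (μ := D.toMeasure)
        (s := {x | firstMatch I x ≠ c.eval x})]
    rw [hμ, pi_consistent_eq]
    calc _ ≤ (Real.exp (-η)) ^ m := by
          refine pow_le_pow_left₀ h2 ?_ _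
          linarith [Real.add_one_le_exp (-η)]
      _ = _ := by rw [← Real.exp_nat_mul]; ring_nf
  have hfail : μ.real Sᶜ < δ := by
    calc μ.real Sᶜ ≤ ∑ I ∈ bad, μ.real {xs | ∀ j, firstMatch I (xs j) = c.eval (xs j)} :=
          (MeasureTheory.measureReal_mono hsub (MeasureTheory.measure_ne_top _ _)).trans
            (MeasureTheory.measureReal_biUnion_finset_le _ _)
      _ ≤ ∑ I ∈ bad, Real.exp (-(η * m)) := Finset.sum_le_sum hone
      _ = bad.card * Real.exp (-(η * m)) := by simp
      _ ≤ Real.exp W.length * Real.exp (-(W.length + 1 / δ)) := by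
          have h1 : bad.card ≤ 2 ^ W.length :=
            (Finset.card_filter_le _ _).trans
              ((List.toFinset_card_le _).trans (List.length_sublists W).le)
          have h2 : (bad.card : ℝ) ≤ 2 ^ W.length := by exact_mod_cast h1
          have h3 : (2 : ℝ) ^ W.length ≤ Real.exp W.length := by
            rw [← Real.exp_one_pow]
            exact pow_le_pow_left₀ (by norm_num) (by linarith [Real.add_one_le_exp 1]) _
          exact mul_le_mul (h2.trans h3) (Real.exp_le_exp.mpr (by linarith))
            (Real.exp_pos _).le (Real.exp_pos _).le
      _ = (Real.exp (1 / δ))⁻¹ := by rw [← Real.exp_add, ← Real.exp_neg]; ring_nf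
      _ < δ := by
          rw [inv_lt_comm₀ (Real.exp_pos _) hδ, ← one_div]
          linarith [Real.add_one_le_exp (1 / δ)]
  have hc := MeasureTheory.probReal_compl_eq_one_sub (μ := μ) (s := S) MeasurableSet.of_discrete
  linarith

end

/-! ### Programs -/

/-- The middle component of a triple. -/
def Prog.mid : Prog := .comp .fst .snd

/-- The last component of a triple. -/
def Prog.last : Prog := .comp .snd .snd

namespace Prog.RunsWithin

variable {f g b : Prog} {x y z u v w : Data} {s t s' : ℕ}

theorem mono (h : f.RunsWithin x y s) (hst : s ≤ t) : f.RunsWithin x y t :=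
  let ⟨r, hr, h⟩ := h
  ⟨r, hr.trans hst, h⟩

theorem skip : Prog.skip.RunsWithin x x 1 := ⟨1, le_rfl, .skip x⟩

theorem nil : Prog.nil.RunsWithin x .nil 1 := ⟨1, le_rfl, .nil x⟩

theorem fst : Prog.fst.RunsWithin x x.left 1 := ⟨1, le_rfl, .fst x⟩

theorem snd : Prog.snd.RunsWithin x x.right 1 := ⟨1, le_rfl, .snd x⟩

theorem pair (hf : f.RunsWithin x y s) (hg : g.RunsWithin x z t) :
    (Prog.pair f g).RunsWithin x (.node y z) (s + t + 1) :=
  let ⟨_, h1, h2⟩ := hf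
  let ⟨_, h3, h4⟩ := hg
  ⟨_, by omega, .pair h2 h4⟩

theorem comp (hf : f.RunsWithin x y s) (hg : g.RunsWithin y z t) :
    (Prog.comp g f).RunsWithin x z (s + t + 1) :=
  let ⟨_, h1, h2⟩ := hf
  let ⟨_, h3, h4⟩ := hg
  ⟨_, by omega, .comp h2 h4⟩

theorem cond {p : Bool} (hb : b.RunsWithin x (encodeBool p) s)
    (hf : p = true → f.RunsWithin x y t) (hg : p = false → g.RunsWithin x y t) :
    (Prog.cond b f g).RunsWithin x y (s + t + 1) := by
  obtain ⟨_, h1, h2⟩ := hb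
  cases p with
  | true =>
    obtain ⟨_, h3, h4⟩ := hf rfl
    exact ⟨_, by omega, .cond_true h2 h4⟩
  | false =>
    obtain ⟨_, h3, h4⟩ := hg rfl
    exact ⟨_, by omega, .cond_false h2 h4⟩

theorem mid : Prog.mid.RunsWithin x x.right.left 3 := snd.comp fst

theorem last : Prog.last.RunsWithin x x.right.right 3 := snd.comp snd

theorem congr (h : f.RunsWithin x y s) (hy : y = z) (hst : s ≤ t) : f.RunsWithin x z t :=
  hy ▸ h.mono hst

end Prog.RunsWithin

namespace Prog

/-- The triple of the results. -/
def triple (f g h : Prog) : Prog := .pair f (.pair g h)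

theorem RunsWithin.triple {f g h : Prog} {x a b c : Data} {r s t : ℕ}
    (hf : f.RunsWithin x a r) (hg : g.RunsWithin x b s) (hh : h.RunsWithin x c t) :
    (Prog.triple f g h).RunsWithin x (.node a (.node b c)) (r + s + t + 2) :=
  (hf.pair (hg.pair hh)).mono (by omega)

/-- `fold f` maps `(e, (a, l))` to the result of replacing `a` by `f (e, (a, d))` for all elements
`d` of the list `l`, in their order. -/
def fold (f : Prog) : Prog :=
  .comp mid (.loop last (.triple .fst
    (.comp f (.triple .fst mid (.comp .fst last))) (.comp .snd last)))

/-- A bound for the number of steps of `fold f` on a list of length `l` if `f` takes at most `t`. -/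
def foldTime (t l : ℕ) : ℕ := (t + 24) * l + 8

/-- The loop keeps the environment, the accumulator and the unread part of the list, and stops when
that part is empty. `Inv` is carried along because the bound `t` for one step may only hold for
accumulators that have not grown. The overhead `24` per element is `20` for the body, `3` for the
test and `1` for the loop. -/
theorem RunsWithin.fold {f : Prog} {β γ : Type*} {encB : β → Data} {encC : γ → Data}
    {G : β → γ → β} (Inv : β → Prop) {t : ℕ} {e : Data} (l : List γ)
    (hstep : ∀ b, Inv b → ∀ c ∈ l,
      f.RunsWithin (.node e (.node (encB b) (encC c))) (encB (G b c)) t ∧ Inv (G b c))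
    {b : β} (hb : Inv b) :
    (Prog.fold f).RunsWithin (.node e (.node (encB b) (encodeList (l.map encC))))
      (encB (l.foldl G b)) (foldTime t l.length) := by
  suffices h : (Prog.loop Prog.last (.triple .fst
      (.comp f (.triple .fst Prog.mid (.comp .fst Prog.last))) (.comp .snd Prog.last))).RunsWithin
      (.node e (.node (encB b) (encodeList (l.map encC))))
      (.node e (.node (encB (l.foldl G b)) .nil)) ((t + 24) * l.length + 4) from
    (h.comp RunsWithin.mid).mono (t := foldTime t l.length) (by unfold foldTime; omega)
  induction l generalizing b with
  | nil =>
    obtain ⟨s, hs, h⟩ := RunsWithin.last (x := .node e (.node (encB b) (encodeList [])))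
    exact ⟨s + 1, by simp; omega, .loop_done h⟩
  | cons c l ih =>
    obtain ⟨hrun, hinv⟩ := hstep b hb c List.mem_cons_self
    obtain ⟨s, hs, h⟩ := ih (fun b hb c hc => hstep b hb c (List.mem_cons_of_mem _ hc)) hinv
    set x : Data := .node e (.node (encB b) (encodeList ((c :: l).map encC))) with hx
    obtain ⟨s', hs', h'⟩ := RunsWithin.last (x := x)
    have hbody : (Prog.triple .fst (.comp f (.triple .fst Prog.mid (.comp .fst Prog.last)))
        (.comp .snd Prog.last)).RunsWithin x
        (.node e (.node (encB (G b c)) (encodeList (l.map encC)))) (t + 20) :=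
      (RunsWithin.triple .fst
        ((RunsWithin.triple .fst .mid (RunsWithin.last.comp .fst)).comp hrun)
        (RunsWithin.last.comp .snd)).mono (by omega)
    obtain ⟨s'', hs'', h''⟩ := hbody
    exact ⟨s' + s'' + s + 1, by rw [List.length_cons, Nat.mul_succ]; omega,
      .loop_step h' h'' h⟩

end Prog

open Prog

/-! ### Programs for bit lists -/

/-- A list of bits as a tree. -/
def encodeBits (l : List Bool) : Data := encodeList (l.map encodeBool)

theorem left_encodeBits (l : List Bool) : (encodeBits l).left = encodeBool (l.headD false) := by
  cases l <;> rfl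

theorem right_encodeBits (l : List Bool) : (encodeBits l).right = encodeBits l.tail := by
  cases l <;> rfl

theorem encodeCube_eq {n : ℕ} (x : Cube n) :
    encodeCube x = encodeList ((List.finRange n).map fun i => encodeBool (x i)) := by
  rw [encodeCube, List.ofFn_eq_map]

/-- The bit `true`. -/
def Prog.tt : Prog := .pair .nil .nil

theorem Prog.RunsWithin.tt {x : Data} : Prog.tt.RunsWithin x (encodeBool true) 3 := nil.pair nil

/-- Reversal of a list. -/
def Prog.rev : Prog := .comp (.fold (.pair last mid)) (.triple .nil .nil .skip)

theorem Prog.RunsWithin.rev (l : List Bool) :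
    Prog.rev.RunsWithin (encodeBits l) (encodeBits l.reverse) (foldTime 7 l.length + 6) := by
  have h := RunsWithin.fold (f := .pair Prog.last Prog.mid) (encB := encodeBits)
    (encC := encodeBool) (G := fun a c => c :: a) (fun _ => True) (e := .nil) (t := 7) l
    (fun b _ c _ => ⟨RunsWithin.pair .last .mid, trivial⟩) (b := []) trivial
  refine ((RunsWithin.triple .nil .nil .skip).comp h).congr ?_ (by omega)
  rw [List.foldl_flip_cons_eq_append']
  simp

/-- The list of as many bits `false` as there are elements in the given list. -/
def Prog.zeros : Prog := .comp (.fold (.pair .nil mid)) (.triple .nil .nil .skip)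

theorem Prog.RunsWithin.zeros (l : List Bool) :
    Prog.zeros.RunsWithin (encodeBits l) (encodeBits (l.map fun _ => false))
      (foldTime 5 l.length + 6) := by
  have h := RunsWithin.fold (f := .pair Prog.nil Prog.mid) (encB := encodeBits)
    (encC := encodeBool) (G := fun a _ => false :: a) (fun _ => True) (e := .nil) (t := 5) l
    (fun b _ c _ => ⟨RunsWithin.pair .nil .mid, trivial⟩) (b := []) trivial
  refine ((RunsWithin.triple .nil .nil .skip).comp h).congr ?_ (by omega)
  -- Consing reverses the list, which is harmless because all its entries are equal.
  have : ∀ (l r : List Bool), l.foldl (fun a _ => false :: a) r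
      = l.map (fun _ => false) ++ r := by
    intro l
    induction l with
    | nil => simp
    | cons a l ih =>
      intro r
      rw [List.foldl_cons, ih, List.map_cons, List.cons_append]
      rw [List.append_cons, List.map_const', ← List.replicate_succ', List.replicate_succ,
        List.cons_append]
  rw [this, List.append_nil]

theorem Prog.RunsWithin.head_rest {x : Data} {r : List Bool}
    (h : x.right.left.right = encodeBits r) :
    (Prog.comp .fst (.comp .snd Prog.mid)).RunsWithin x (encodeBool (r.headD false)) 7 :=
  ((RunsWithin.mid.comp .snd).comp .fst).congr (by rw [h, left_encodeBits]) (by omega)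

/-- From `(a, b)`, whether each bit of the list `a` is at most the bit of `b` at its place. -/
def Prog.subset : Prog :=
  .comp .fst (.comp (.fold (.pair
      (.cond last (.cond (.comp .fst (.comp .snd mid)) (.comp .fst mid) .nil) (.comp .fst mid))
      (.comp .snd (.comp .snd mid))))
    (.triple .nil (.pair tt .snd) .fst))

/-- A bound for the number of steps of `subset`. -/
def subsetTime (N : ℕ) : ℕ := foldTime 40 N + 20

/-- The accumulator holds the verdict and the unread part of the second list, so that one fold walks
through two lists. -/
theorem foldl_subset {ι : Type*} (l : List ι) (a b : ι → Bool) (ok : Bool) :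
    (l.map a).foldl (fun (p : Bool × List Bool) e => (p.1 && (!e || p.2.headD false), p.2.tail))
      (ok, l.map b) = (ok && l.all fun i => !a i || b i, []) := by
  induction l generalizing ok with
  | nil => simp
  | cons i l ih => simp only [List.map_cons, List.foldl_cons, List.headD_cons, List.tail_cons, ih,
      List.all_cons, Bool.and_assoc]

theorem Prog.RunsWithin.subset {ι : Type*} (l : List ι) (a b : ι → Bool) :
    Prog.subset.RunsWithin (.node (encodeBits (l.map a)) (encodeBits (l.map b)))
      (encodeBool (l.all fun i => !a i || b i)) (subsetTime l.length) := by
  let encB : Bool × List Bool → Data := fun p => .node (encodeBool p.1) (encodeBits p.2)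
  have h := RunsWithin.fold (f := .pair
      (.cond Prog.last (.cond (.comp .fst (.comp .snd Prog.mid)) (.comp .fst Prog.mid) .nil)
        (.comp .fst Prog.mid))
      (.comp .snd (.comp .snd Prog.mid))) (encB := encB) (encC := encodeBool)
    (G := fun p e => (p.1 && (!e || p.2.headD false), p.2.tail)) (fun _ => True) (e := .nil)
    (t := 40) (l.map a) (fun p _ e _ => ⟨?_, trivial⟩) (b := (true, l.map b)) trivial
  · refine ((RunsWithin.triple .nil (RunsWithin.tt.pair .snd) .fst).comp h).comp .fst |>.congr ?_ ?_
    · rw [foldl_subset]; rfl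
    · rw [List.length_map]; unfold subsetTime; omega
  · refine (RunsWithin.pair (RunsWithin.cond (p := e) (t := 20)
      (y := encodeBool (p.1 && (!e || p.2.headD false))) RunsWithin.last ?_ ?_)
      ((RunsWithin.mid.comp .snd).comp .snd)).congr ?_ ?_
    · rintro rfl
      refine (RunsWithin.cond (p := p.2.headD false) (t := 8) (RunsWithin.head_rest rfl)
        (fun h => ?_) (fun h => ?_)).mono (by omega)
      · exact (RunsWithin.mid.comp .fst).congr (by rw [h]; simp; rfl) (by omega)
      · exact RunsWithin.nil.congr (by rw [h]; simp; rfl) (by omega)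
    · rintro rfl
      exact (RunsWithin.mid.comp .fst).congr (by simp; rfl) (by omega)
    · change Data.node _ (encodeBits p.2).right = _
      rw [right_encodeBits]
    · omega

/-- From `(a, b)`, the disjunctions of the bits of the list `a` with those of `b`. -/
def Prog.union : Prog :=
  .comp rev (.comp .fst (.comp (.fold (.pair
      (.pair (.cond last tt (.comp .fst (.comp .snd mid))) (.comp .fst mid))
      (.comp .snd (.comp .snd mid))))
    (.triple .nil (.pair .nil .snd) .fst)))

/-- A bound for the number of steps of `union`. -/
def unionTime (N : ℕ) : ℕ := foldTime 40 N + foldTime 7 N + 40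

/-- The result is consed together backwards, hence the final `rev` in `Prog.union`. -/
theorem foldl_union {ι : Type*} (l : List ι) (a b : ι → Bool) (o : List Bool) :
    (l.map a).foldl (fun (p : List Bool × List Bool) e =>
      ((e || p.2.headD false) :: p.1, p.2.tail)) (o, l.map b)
      = ((l.map fun i => a i || b i).reverse ++ o, []) := by
  induction l generalizing o with
  | nil => simp
  | cons i l ih => simp only [List.map_cons, List.foldl_cons, List.headD_cons, List.tail_cons, ih,
      List.reverse_cons, List.append_assoc, List.singleton_append]

theorem Prog.RunsWithin.union {ι : Type*} (l : List ι) (a b : ι → Bool) :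
    Prog.union.RunsWithin (.node (encodeBits (l.map a)) (encodeBits (l.map b)))
      (encodeBits (l.map fun i => a i || b i)) (unionTime l.length) := by
  let encB : List Bool × List Bool → Data := fun p => .node (encodeBits p.1) (encodeBits p.2)
  have h := RunsWithin.fold (f := .pair
      (.pair (.cond Prog.last Prog.tt (.comp .fst (.comp .snd Prog.mid))) (.comp .fst Prog.mid))
      (.comp .snd (.comp .snd Prog.mid))) (encB := encB) (encC := encodeBool)
    (G := fun p e => ((e || p.2.headD false) :: p.1, p.2.tail)) (fun _ => True) (e := .nil)
    (t := 40) (l.map a) (fun p _ e _ => ⟨?_, trivial⟩) (b := ([], l.map b)) trivial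
  · rw [foldl_union] at h
    have hrev := RunsWithin.rev (l.map fun i => a i || b i).reverse
    rw [List.reverse_reverse] at hrev
    refine (((RunsWithin.triple .nil (RunsWithin.nil.pair .snd) .fst).comp h).comp
      (RunsWithin.fst.congr ?_ le_rfl)).comp hrev |>.mono ?_
    · rw [List.append_nil]; rfl
    · simp only [List.length_map, List.length_reverse]; unfold unionTime; omega
  · refine (RunsWithin.pair (RunsWithin.pair
      (RunsWithin.cond (p := e) (t := 9)
      (y := encodeBool (e || p.2.headD false)) RunsWithin.last ?_ ?_) (RunsWithin.mid.comp .fst))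
      ((RunsWithin.mid.comp .snd).comp .snd)).congr ?_ ?_
    · rintro rfl
      exact RunsWithin.tt.congr (by simp) (by omega)
    · rintro rfl
      exact (RunsWithin.head_rest rfl).congr (by simp) (by omega)
    · change Data.node (.node _ (encodeBits p.1)) (encodeBits p.2).right = _
      rw [right_encodeBits]
      rfl
    · omega


/-! ### Features -/

/-- The constant `true` and all literals, as functions. -/
def literals (n : ℕ) : List (Cube n → Bool) :=
  (List.finRange n).foldl (fun acc i => (fun x => x i) :: (fun x => !x i) :: acc) [fun _ => true]

/-- The conjunctions of a function in `Ls` with one in `Fs`. -/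
def products {X : Type*} (Ls Fs : List (X → Bool)) : List (X → Bool) :=
  Ls.foldl (fun acc l => Fs.foldl (fun acc f => (fun x => l x && f x) :: acc) acc) []

/-- The conjunctions of `k` functions out of `literals n`. -/
def features (n : ℕ) : ℕ → List (Cube n → Bool)
  | 0 => [fun _ => true]
  | k + 1 => products (literals n) (features n k)

/-- The values at `x` of the functions in a list, as a tree. -/
def encodeValues {X : Type*} (x : X) (Fs : List (X → Bool)) : Data :=
  encodeBits (Fs.map fun f => f x)

theorem encodeValues_eq {X : Type*} (x : X) (Fs : List (X → Bool)) :
    encodeValues x Fs = encodeList (Fs.map fun f => encodeBool (f x)) := by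
  simp [encodeValues, encodeBits, Function.comp_def]

theorem foldl_cons_map {β γ : Type*} (g : β → γ) (l : List β) (acc : List γ) :
    l.foldl (fun acc f => g f :: acc) acc = (l.map g).reverse ++ acc := by
  induction l generalizing acc with
  | nil => simp
  | cons a l ih => simp [ih]

theorem mem_products {X : Type*} {Ls Fs : List (X → Bool)} {h : X → Bool} :
    h ∈ products Ls Fs ↔ ∃ l ∈ Ls, ∃ f ∈ Fs, h = fun x => l x && f x := by
  suffices H : ∀ acc : List (X → Bool),
      h ∈ Ls.foldl (fun acc l => Fs.foldl (fun acc f => (fun x => l x && f x) :: acc) acc) acc ↔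
        h ∈ acc ∨ ∃ l ∈ Ls, ∃ f ∈ Fs, h = fun x => l x && f x by
    exact (H []).trans (by simp)
  induction Ls with
  | nil => simp
  | cons l Ls ih =>
    intro acc
    rw [List.foldl_cons, ih, foldl_cons_map fun (f : X → Bool) x => l x && f x]
    simp only [List.mem_append, List.mem_reverse, List.mem_map, List.exists_mem_cons_iff, eq_comm]
    rw [or_comm (b := h ∈ acc), or_assoc]

theorem length_products {X : Type*} (Ls Fs : List (X → Bool)) :
    (products Ls Fs).length = Ls.length * Fs.length := by
  suffices H : ∀ acc : List (X → Bool),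
      (Ls.foldl (fun acc l => Fs.foldl (fun acc f => (fun x => l x && f x) :: acc) acc)
        acc).length = acc.length + Ls.length * Fs.length by
    exact (H []).trans (by simp)
  induction Ls with
  | nil => simp
  | cons l Ls ih =>
    intro acc
    rw [List.foldl_cons, ih, foldl_cons_map fun (f : X → Bool) x => l x && f x]
    simp only [List.length_append, List.length_reverse, List.length_map, List.length_cons]
    ring

theorem mem_literals {n : ℕ} {h : Cube n → Bool} :
    h ∈ literals n ↔ h = (fun _ => true) ∨ ∃ i, h = (fun x => x i) ∨ h = fun x => !x i := by
  suffices H : ∀ (l : List (Fin n)) (acc : List (Cube n → Bool)),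
      h ∈ l.foldl (fun acc i => (fun x => x i) :: (fun x => !x i) :: acc) acc ↔
        h ∈ acc ∨ ∃ i ∈ l, h = (fun x => x i) ∨ h = fun x => !x i by
    exact (H (List.finRange n) [fun _ => true]).trans (by simp)
  intro l
  induction l with
  | nil => simp
  | cons i l ih =>
    intro acc
    rw [List.foldl_cons, ih]
    rw [List.exists_mem_cons_iff, List.mem_cons, List.mem_cons, ← or_assoc,
      or_comm (b := h ∈ acc), or_assoc]

theorem length_literals (n : ℕ) : (literals n).length = 2 * n + 1 := by
  suffices H : ∀ (l : List (Fin n)) (acc : List (Cube n → Bool)),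
      (l.foldl (fun acc i => (fun x => x i) :: (fun x => !x i) :: acc) acc).length
        = acc.length + 2 * l.length by
    rw [literals, H]; simp; omega
  intro l
  induction l with
  | nil => simp
  | cons i l ih =>
    intro acc
    rw [List.foldl_cons, ih]
    simp only [List.length_cons]
    omega

theorem length_features (n k : ℕ) : (features n k).length = (2 * n + 1) ^ k := by
  induction k with
  | zero => rfl
  | succ k ih => rw [features, length_products, ih, length_literals, pow_succ']

/-- Every `k`-term is a feature. -/
theorem Term.eval_mem_features {n k : ℕ} (K : Term k n) : K.eval ∈ features n k := by
  classical
  obtain ⟨K, hK⟩ := K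
  induction k generalizing K with
  | zero =>
    have : K = ∅ := Finset.card_eq_zero.mp (Nat.le_zero.mp hK)
    subst this
    simp only [features, List.mem_singleton]
    funext x
    simp [Term.eval]
  | succ k ih =>
    rw [features, mem_products]
    rcases K.eq_empty_or_nonempty with rfl | ⟨l, hl⟩
    -- The constant `true` among the literals pads terms with fewer than `k` literals.
    · refine ⟨fun _ => true, mem_literals.mpr (.inl rfl), _, ih ∅ (by simp), ?_⟩
      funext x
      simp [Term.eval]
    · refine ⟨fun x => decide (x l.1 = l.2), mem_literals.mpr (.inr ⟨l.1, ?_⟩), _,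
        ih (K.erase l) (by rw [Finset.card_erase_of_mem hl]; omega), ?_⟩
      · rcases l with ⟨i, b⟩
        cases b <;> simp
      · funext x
        have : (∀ j ∈ K, x j.1 = j.2) ↔ x l.1 = l.2 ∧ ∀ j ∈ K.erase l, x j.1 = j.2 := by
          conv_lhs => rw [← Finset.insert_erase hl]
          rw [Finset.forall_mem_insert]
        simp only [Term.eval, this, Bool.decide_and]

/-- Every feature is a `k`-term. -/
theorem exists_term_of_mem_features {n k : ℕ} {f : Cube n → Bool} (hf : f ∈ features n k) :
    ∃ K : Term k n, f = K.eval := by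
  classical
  induction k generalizing f with
  | zero =>
    simp only [features, List.mem_singleton] at hf
    exact ⟨⟨∅, by simp⟩, by subst hf; funext x; simp [Term.eval]⟩
  | succ k ih =>
    rw [features, mem_products] at hf
    obtain ⟨l, hl, g, hg, rfl⟩ := hf
    obtain ⟨⟨K, hK⟩, rfl⟩ := ih hg
    rcases mem_literals.mp hl with rfl | ⟨i, rfl | rfl⟩
    · exact ⟨⟨K, by omega⟩, by funext x; simp [Term.eval]⟩
    · refine ⟨⟨insert (i, true) K, (Finset.card_insert_le _ _).trans (by omega)⟩, ?_⟩
      funext x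
      simp [Term.eval]
    · refine ⟨⟨insert (i, false) K, (Finset.card_insert_le _ _).trans (by omega)⟩, ?_⟩
      funext x
      simp [Term.eval]

/-! ### Programs computing the features of a point -/

/-- Negation of a bit. -/
def Prog.not : Prog := .cond .skip .nil tt

theorem Prog.RunsWithin.not (b : Bool) : Prog.not.RunsWithin (encodeBool b) (encodeBool !b) 5 :=
  (RunsWithin.cond (p := b) (t := 3) (y := encodeBool !b) RunsWithin.skip
    (by rintro rfl; exact RunsWithin.nil.mono (by omega))
    (by rintro rfl; exact RunsWithin.tt)).mono (by omega)

/-- From a point, the values of the literals. -/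
def Prog.literals : Prog :=
  .comp (.fold (.triple last (.comp .not last) mid)) (.triple .nil (.pair tt .nil) .skip)

/-- The list of literals is itself a left fold by consing, so the program yields their values in the
same order, without any reversal. -/
theorem Prog.RunsWithin.literals {n : ℕ} (x : Cube n) :
    Prog.literals.RunsWithin (encodeCube x) (encodeValues x (RobustLearning.literals n))
      (foldTime 20 n + 10) := by
  rw [encodeCube_eq]
  have h := RunsWithin.fold (f := .triple Prog.last (.comp .not Prog.last) Prog.mid)
    (encB := encodeValues x) (encC := fun i => encodeBool (x i))
    (G := fun acc i => (fun x => x i) :: (fun x => !x i) :: acc) (fun _ => True) (e := .nil)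
    (t := 20) (List.finRange n)
    (fun b _ i _ => ⟨(RunsWithin.triple .last (RunsWithin.last.comp (.not (x i))) .mid).mono
      (by omega), trivial⟩) (b := [fun _ => true]) trivial
  rw [List.length_finRange] at h
  exact ((RunsWithin.triple .nil (RunsWithin.tt.pair .nil) .skip).comp h).mono (by omega)

/-- From the values of `Ls` and those of `Fs`, the values of their products. -/
def Prog.products : Prog :=
  .comp (.fold (.comp (.fold (.pair (.cond .fst last .nil) mid)) (.triple last mid .fst)))
    (.triple .snd .nil .fst)

/-- A bound for the number of steps of `products`. -/
def productsTime (M N : ℕ) : ℕ := foldTime (foldTime 20 N + 20) M + 10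

theorem Prog.RunsWithin.products {X : Type*} (Ls Fs : List (X → Bool)) (x : X) :
    Prog.products.RunsWithin (.node (encodeValues x Ls) (encodeValues x Fs))
      (encodeValues x (RobustLearning.products Ls Fs)) (productsTime Ls.length Fs.length) := by
  have hin : ∀ (l : X → Bool) (acc : List (X → Bool)),
      (Prog.fold (.pair (.cond .fst Prog.last .nil) Prog.mid)).RunsWithin
        (.node (encodeBool (l x)) (.node (encodeValues x acc) (encodeValues x Fs)))
        (encodeValues x (Fs.foldl (fun acc f => (fun x => l x && f x) :: acc) acc))
        (foldTime 20 Fs.length) := by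
    intro l acc
    have h := RunsWithin.fold (f := .pair (.cond .fst Prog.last .nil) Prog.mid)
      (encB := encodeValues x) (encC := fun f : X → Bool => encodeBool (f x))
      (G := fun acc f => (fun x => l x && f x) :: acc) (fun _ => True) (e := encodeBool (l x))
      (t := 20) Fs (fun b _ f _ => ⟨?_, trivial⟩) (b := acc) trivial
    · rwa [← encodeValues_eq] at h
    · refine (RunsWithin.pair (RunsWithin.cond (p := l x) (t := 3) (y := encodeBool (l x && f x))
        RunsWithin.fst (fun h => ?_) (fun h => ?_)) RunsWithin.mid).mono (by omega)
      · rw [h]; exact RunsWithin.last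
      · rw [h]; exact RunsWithin.nil.mono (by omega)
  have h := RunsWithin.fold
    (f := .comp (.fold (.pair (.cond .fst Prog.last .nil) Prog.mid))
      (.triple Prog.last Prog.mid .fst))
    (encB := encodeValues x) (encC := fun f : X → Bool => encodeBool (f x))
    (G := fun acc l => Fs.foldl (fun acc f => (fun x => l x && f x) :: acc) acc) (fun _ => True)
    (e := encodeValues x Fs) (t := foldTime 20 Fs.length + 20) Ls
    (fun b _ l _ => ⟨((RunsWithin.triple .last .mid .fst).comp (hin l b)).mono (by omega),
      trivial⟩) (b := []) trivial
  rw [← encodeValues_eq] at h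
  exact ((RunsWithin.triple .snd .nil .fst).comp h).mono (by unfold productsTime; omega)

/-- From the values of the literals, the values of the features. -/
def Prog.featuresOfLiterals : ℕ → Prog
  | 0 => .pair tt .nil
  | k + 1 => .comp .products (.pair .skip (featuresOfLiterals k))

/-- From a point, the values of the features. -/
def Prog.features (k : ℕ) : Prog := .comp (featuresOfLiterals k) .literals

/-- A bound for the number of steps of `features k`. -/
def featuresTime (n k : ℕ) : ℕ :=
  k * (productsTime (2 * n + 1) ((2 * n + 1) ^ k) + 3) + foldTime 20 n + 20

theorem foldTime_mono {s t l m : ℕ} (h : s ≤ t) (h' : l ≤ m) : foldTime s l ≤ foldTime t m := by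
  unfold foldTime; gcongr

theorem Prog.RunsWithin.features {n : ℕ} (k : ℕ) (x : Cube n) :
    (Prog.features k).RunsWithin (encodeCube x) (encodeValues x (RobustLearning.features n k))
      (featuresTime n k) := by
  -- Each of the levels is charged the cost of multiplying by a list of the final size.
  suffices h : ∀ j ≤ k, (Prog.featuresOfLiterals j).RunsWithin
      (encodeValues x (RobustLearning.literals n)) (encodeValues x (RobustLearning.features n j))
      (j * (productsTime (2 * n + 1) ((2 * n + 1) ^ k) + 3) + 5) from
    ((RunsWithin.literals x).comp (h k le_rfl)).mono (by unfold featuresTime; omega)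
  intro j
  induction j with
  | zero => exact fun _ => (RunsWithin.tt.pair .nil).mono (by omega)
  | succ j ih =>
    intro hj
    have h := RunsWithin.products (RobustLearning.literals n) (RobustLearning.features n j) x
    refine ((RunsWithin.pair .skip (ih (by omega))).comp h).mono ?_
    have : productsTime (RobustLearning.literals n).length (RobustLearning.features n j).length
        ≤ productsTime (2 * n + 1) ((2 * n + 1) ^ k) := by
      rw [length_literals, length_features]
      unfold productsTime
      gcongr
      refine foldTime_mono ?_ le_rfl
      gcongr
      exact foldTime_mono le_rfl (Nat.pow_le_pow_right (by omega) (by omega))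
    rw [Nat.succ_mul j]
    omega


/-! ### The learner

In each round, the learner takes all features that are false at all remaining points with label
`false` or at all those with label `true`, and removes the points at which one of them is true. -/

section

variable {X : Type*} {Fs : List (X → Bool)} {S : List (X × Bool)}

/-- Whether `f` is true at some point of `S` with label `v`. -/
def conflicts (S : List (X × Bool)) (v : Bool) (f : X → Bool) : Bool :=
  S.any fun s => (s.2 == v) && f s.1

/-- Whether all features that are true at `x` belong to `a`. -/
def within (Fs : List (X → Bool)) (a : (X → Bool) → Bool) (x : X) : Bool :=
  Fs.all fun f => !f x || a f

/-- The features not to be taken with the label `true`, and those not to be taken with `false`. -/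
abbrev Round (X : Type*) : Type _ := ((X → Bool) → Bool) × ((X → Bool) → Bool)

/-- The round of the learner for the remaining sample `S`. -/
def roundOf (S : List (X × Bool)) : Round X := (conflicts S false, conflicts S true)

/-- The points of the sample left over by a round (in reverse order). -/
def remaining (Fs : List (X → Bool)) (p : Round X) (S : List (X × Bool)) : List (X × Bool) :=
  (S.filter fun s => within Fs p.1 s.1 && within Fs p.2 s.1).reverse

/-- One step of the learner. -/
def learnStep (Fs : List (X → Bool)) (st : List (X × Bool) × List (Round X)) :
    List (X × Bool) × List (Round X) :=
  (remaining Fs (roundOf st.1) st.1, roundOf st.1 :: st.2)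

/-- The answer of a round, and `ans` if it has none. -/
def override (Fs : List (X → Bool)) (x : X) (ans : Bool) (p : Round X) : Bool :=
  if within Fs p.1 x then if within Fs p.2 x then ans else false else true

/-- The hypothesis given by a list of rounds, the last round first. -/
def hypothesis (Fs : List (X → Bool)) (H : List (Round X)) (x : X) : Bool :=
  H.foldl (override Fs x) false

/-- The rounds of the learner on the sample `S`, the last round first. -/
def learn (Fs : List (X → Bool)) (S : List (X × Bool)) : List (Round X) :=
  ((learnStep Fs)^[if S = [] then 0 else Fs.length] (S, [])).2

theorem within_eq_false {a : (X → Bool) → Bool} {x : X} {f : X → Bool} (hf : f ∈ Fs)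
    (hx : f x = true) (ha : a f = false) : within Fs a x = false := by
  unfold within
  rw [List.all_eq_false]
  exact ⟨f, hf, by simp [hx, ha]⟩

/-- A feature that is true at `s` conflicts with the label of `s`, so it is not taken with the
opposite label. Hence no round answers wrongly at a point of its own sample. -/
theorem within_conflicts {s : X × Bool} (hs : s ∈ S) : within Fs (conflicts S s.2) s.1 = true := by
  unfold within
  rw [List.all_eq_true]
  intro f _
  cases hf : f s.1 with
  | false => simp
  | true =>
    have : conflicts S s.2 f = true := List.any_eq_true.mpr ⟨s, hs, by simp [hf]⟩
    simp [this]

theorem mem_remaining {p : Round X} {s : X × Bool} :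
    s ∈ remaining Fs p S ↔ s ∈ S ∧ within Fs p.1 s.1 = true ∧ within Fs p.2 s.1 = true := by
  simp [remaining]

theorem override_eq_self {x : X} {ans : Bool} {p : Round X} (h1 : within Fs p.1 x = true)
    (h2 : within Fs p.2 x = true) : override Fs x ans p = ans := by
  simp [override, h1, h2]

/-- A round gives the right answer at the points that it removes. -/
theorem override_roundOf {s : X × Bool} (hs : s ∈ S) (hr : s ∉ remaining Fs (roundOf S) S)
    (ans : Bool) : override Fs s.1 ans (roundOf S) = s.2 := by
  have hw := within_conflicts (Fs := Fs) hs
  rw [mem_remaining] at hr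
  obtain ⟨x, v⟩ := s
  unfold roundOf at hr ⊢
  unfold override
  cases v <;> simp_all

/-- Some feature that is true at a remaining point is taken in the next round. -/
theorem exists_taken {J : List ((X → Bool) × Bool)} (hS : ∀ s ∈ S, s.2 = firstMatch J s.1)
    {s : X × Bool} (hs : s ∈ S) {q : (X → Bool) × Bool} (hq : q ∈ J) (hqs : q.1 s.1 = true) :
    ∃ p ∈ J, (∃ s ∈ S, p.1 s.1 = true) ∧ ∀ s ∈ S, p.1 s.1 = true → s.2 = p.2 := by
  induction J with
  | nil => simp at hq
  | cons p J ih =>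
    -- The item sought is the first one that is true anywhere on `S`: no earlier item intervenes, so
    -- it determines the label wherever it is true.
    by_cases hp : ∃ s ∈ S, p.1 s.1 = true
    · exact ⟨p, List.mem_cons_self, hp, fun s hs h => by rw [hS s hs]; simp [firstMatch, h]⟩
    · push Not at hp
      rcases List.mem_cons.mp hq with rfl | hq
      · exact absurd hqs (hp s hs)
      · obtain ⟨p', hp', h⟩ := ih (fun s hs => by
          rw [hS s hs]; simp [firstMatch, hp s hs]) hq
        exact ⟨p', List.mem_cons_of_mem _ hp', h⟩

/-- The features that are true at some point of the sample. -/
def alive (Fs : List (X → Bool)) (S : List (X × Bool)) : List (X → Bool) :=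
  Fs.filter fun f => S.any fun s => f s.1

/-- The feature from `exists_taken` is true somewhere on `S`, but the round removes all points where
it is true. No feature becomes alive again, since the sample only shrinks. -/
theorem length_alive_remaining_lt {J : List ((X → Bool) × Bool)}
    (hJ : ∀ p ∈ J, p.1 ∈ Fs) (hS : ∀ s ∈ S, s.2 = firstMatch J s.1) {s : X × Bool} (hs : s ∈ S)
    {q : (X → Bool) × Bool} (hq : q ∈ J) (hqs : q.1 s.1 = true) :
    (alive Fs (remaining Fs (roundOf S) S)).length < (alive Fs S).length := by
  obtain ⟨p, hp, ⟨s', hs', hps'⟩, hval⟩ := exists_taken hS hs hq hqs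
  have h1 : alive Fs (remaining Fs (roundOf S) S)
      = (alive Fs S).filter fun f => (remaining Fs (roundOf S) S).any fun s => f s.1 := by
    unfold alive
    rw [List.filter_filter]
    refine List.filter_congr fun f _ => ?_
    rw [Bool.eq_iff_iff]
    simp only [Bool.and_eq_true, List.any_eq_true]
    exact ⟨fun ⟨t, ht, hf⟩ => ⟨⟨t, ht, hf⟩, t, (mem_remaining.mp ht).1, hf⟩, And.left⟩
  rw [h1, List.length_filter_lt_length_iff_exists]
  refine ⟨p.1, List.mem_filter.mpr ⟨hJ p hp, List.any_eq_true.mpr ⟨s', hs', hps'⟩⟩, ?_⟩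
  rw [List.any_eq_true]
  rintro ⟨t, ht, hpt⟩
  rw [mem_remaining] at ht
  have hno : conflicts S (!p.2) p.1 = false := by
    unfold conflicts
    rw [List.any_eq_false]
    intro u hu h
    rw [Bool.and_eq_true, beq_iff_eq] at h
    have := hval u hu h.2
    rw [h.1] at this
    cases h2 : p.2 <;> simp [h2] at this
  have hw := within_eq_false (hJ p hp) hpt hno
  unfold roundOf at ht
  cases h2 : p.2 <;> simp_all

/-- After `t` rounds, the removed points are classified correctly, the remaining ones are not
classified, and at least `t` features are false at all of these. -/
theorem learnStep_iterate {J : List ((X → Bool) × Bool)} (hJ : ∀ p ∈ J, p.1 ∈ Fs)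
    (hJtrue : ∃ q ∈ J, ∀ x, q.1 x = true) (hS : ∀ s ∈ S, s.2 = firstMatch J s.1) (t : ℕ) :
    (∀ s ∈ ((learnStep Fs)^[t] (S, [])).1, s ∈ S) ∧
    (∀ s ∈ S, (s ∈ ((learnStep Fs)^[t] (S, [])).1 ∧
        ∀ b, ((learnStep Fs)^[t] (S, [])).2.foldl (override Fs s.1) b = b) ∨
      ∀ b, ((learnStep Fs)^[t] (S, [])).2.foldl (override Fs s.1) b = s.2) ∧
    (((learnStep Fs)^[t] (S, [])).1 = [] ∨
      (alive Fs ((learnStep Fs)^[t] (S, [])).1).length + t ≤ Fs.length) := by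
  obtain ⟨q, hq, hqtrue⟩ := hJtrue
  induction t with
  | zero =>
    exact ⟨fun s hs => hs, fun s hs => .inl ⟨hs, fun b => rfl⟩,
      .inr (List.length_filter_le _ _)⟩
  | succ t ih =>
    rw [Function.iterate_succ_apply']
    set st := (learnStep Fs)^[t] (S, []) with hst
    obtain ⟨ih1, ih2, ih3⟩ := ih
    refine ⟨fun s hs => ih1 s (mem_remaining.mp hs).1, fun s hs => ?_, ?_⟩
    · rcases ih2 s hs with ⟨hmem, hb⟩ | hb
      · by_cases hr : s ∈ remaining Fs (roundOf st.1) st.1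
        · refine .inl ⟨hr, fun b => ?_⟩
          -- The newest round is at the head of the list, so it is applied first and earlier rounds
          -- take precedence over it.
          change st.2.foldl _ (override Fs s.1 b _) = b
          rw [hb, override_eq_self (mem_remaining.mp hr).2.1 (mem_remaining.mp hr).2.2]
        · refine .inr fun b => ?_
          change st.2.foldl _ (override Fs s.1 b _) = s.2
          rw [hb, override_roundOf hmem hr]
      · exact .inr fun b => hb _
    · rcases List.eq_nil_or_concat st.1 with h0 | ⟨l, s, hl⟩
      · exact .inl (by simp [learnStep, h0, remaining])
      · have hs : s ∈ st.1 := by rw [hl]; simp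
        have := length_alive_remaining_lt hJ (fun s hs => hS s (ih1 s hs)) hs hq (hqtrue _)
        rcases ih3 with h0 | h3
        · simp [h0] at hs
        · exact .inr (by
            change (alive Fs (remaining Fs (roundOf st.1) st.1)).length + (t + 1) ≤ _
            omega)

/-- The hypothesis of the learner is consistent with the sample. -/
theorem hypothesis_learn {J : List ((X → Bool) × Bool)} (hJ : ∀ p ∈ J, p.1 ∈ Fs)
    (hJtrue : ∃ q ∈ J, ∀ x, q.1 x = true) (hS : ∀ s ∈ S, s.2 = firstMatch J s.1)
    {s : X × Bool} (hs : s ∈ S) : hypothesis Fs (learn Fs S) s.1 = s.2 := by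
  obtain ⟨h1, h2, h3⟩ := learnStep_iterate hJ hJtrue hS Fs.length
  obtain ⟨q, hq, hqtrue⟩ := hJtrue
  unfold hypothesis learn
  rw [if_neg (List.ne_nil_of_mem hs)]
  rcases h2 s hs with ⟨hmem, -⟩ | h
  · rcases h3 with h0 | h3
    · simp [h0] at hmem
    -- A point left after `Fs.length` rounds would keep the always true test alive, while no feature
    -- can be alive any more.
    · have : q.1 ∈ alive Fs ((learnStep Fs)^[Fs.length] (S, [])).1 :=
        List.mem_filter.mpr ⟨hJ q hq, List.any_eq_true.mpr ⟨s, hmem, hqtrue _⟩⟩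
      have := List.length_pos_of_mem this
      omega
  · exact h false

/-! ### Hypotheses as sublists of a fixed first-match list -/

/-- The labelled features taken in a round. -/
def taken (Fs : List (X → Bool)) (p : Round X) : List ((X → Bool) × Bool) :=
  (Fs.filter fun f => !p.1 f).map (·, true) ++ (Fs.filter fun f => !p.2 f).map (·, false)

/-- All features with both labels, `r` times. -/
def allRounds (Fs : List (X → Bool)) (r : ℕ) : List ((X → Bool) × Bool) :=
  (List.replicate r (Fs.map (·, true) ++ Fs.map (·, false))).flatten

theorem length_allRounds (Fs : List (X → Bool)) (r : ℕ) :
    (allRounds Fs r).length = r * (2 * Fs.length) := by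
  simp [allRounds, two_mul]

theorem mem_allRounds {r : ℕ} {p : (X → Bool) × Bool} (hp : p ∈ allRounds Fs r) : p.1 ∈ Fs := by
  simp only [allRounds, List.mem_flatten, List.mem_replicate] at hp
  obtain ⟨l, ⟨-, rfl⟩, hp⟩ := hp
  rw [List.mem_append, List.mem_map, List.mem_map] at hp
  rcases hp with ⟨f, hf, rfl⟩ | ⟨f, hf, rfl⟩ <;> exact hf

theorem firstMatch_append_map (l : List (X → Bool)) (v : Bool) (I : List ((X → Bool) × Bool))
    (x : X) : firstMatch (l.map (·, v) ++ I) x = if l.any (· x) then v else firstMatch I x := by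
  induction l with
  | nil => simp
  | cons f l ih =>
    cases hf : f x with
    | true => simp [firstMatch, hf]
    | false =>
      have : firstMatch ((f :: l).map (·, v) ++ I) x = firstMatch (l.map (·, v) ++ I) x := by
        simp [firstMatch, hf]
      rw [this, ih]
      simp [hf]

theorem any_filter_not (a : (X → Bool) → Bool) (x : X) :
    ((Fs.filter fun f => !a f).any (· x)) = !within Fs a x := by
  rw [within, List.any_filter, List.not_all_eq_any_not]
  congr 1
  funext f
  cases f x <;> cases a f <;> rfl

/-- In `taken` the features labelled `true` come first, in the order in which `override` tests the
two predicates. -/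
theorem firstMatch_taken (p : Round X) (I : List ((X → Bool) × Bool)) (x : X) :
    firstMatch (taken Fs p ++ I) x = override Fs x (firstMatch I x) p := by
  rw [taken, List.append_assoc, firstMatch_append_map, firstMatch_append_map, any_filter_not,
    any_filter_not, override]
  cases within Fs p.1 x <;> cases within Fs p.2 x <;> rfl

theorem taken_sublist (p : Round X) :
    (taken Fs p).Sublist (Fs.map (·, true) ++ Fs.map (·, false)) :=
  (List.filter_sublist.map _).append (List.filter_sublist.map _)

/-- A hypothesis of the learner is a first-match list. -/
theorem exists_firstMatch_eq (H : List (Round X)) {r : ℕ} (hr : H.length ≤ r) :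
    ∃ I, I.Sublist (allRounds Fs r) ∧ hypothesis Fs H = firstMatch I := by
  suffices h : ∀ (R : List (Round X)) (r : ℕ), R.length ≤ r →
      ∃ I, I.Sublist (allRounds Fs r) ∧
        (fun x => R.foldr (fun p ans => override Fs x ans p) false) = firstMatch I by
    obtain ⟨I, hI, h⟩ := h H.reverse r (by simpa using hr)
    refine ⟨I, hI, ?_⟩
    rw [← h]
    funext x
    rw [List.foldr_reverse]
    rfl
  intro R
  induction R with
  | nil => exact fun r _ => ⟨[], List.nil_sublist _, by funext x; simp [firstMatch]⟩
  | cons p R ih =>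
    intro r hr
    obtain ⟨r, rfl⟩ : ∃ r', r = r' + 1 := ⟨r - 1, by simp at hr; omega⟩
    obtain ⟨I, hI, h⟩ := ih r (by simpa using hr)
    refine ⟨taken Fs p ++ I, ?_, ?_⟩
    · rw [allRounds, List.replicate_succ, List.flatten_cons]
      exact (taken_sublist p).append hI
    · funext x
      rw [firstMatch_taken, ← h]
      rfl

/-- The number of rounds does not depend on the sample size; this makes the evaluation time
polynomial in `n` alone. -/
theorem length_learn_le (Fs : List (X → Bool)) (S : List (X × Bool)) :
    (learn Fs S).length ≤ Fs.length := by
  have h : ∀ t, ((learnStep Fs)^[t] (S, [])).2.length = t := by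
    intro t
    induction t with
    | zero => rfl
    | succ t ih => rw [Function.iterate_succ_apply', learnStep, List.length_cons, ih]
  rw [learn, h]
  split_ifs
  exacts [Nat.zero_le _, le_rfl]

end

/-! ### The learner as a program -/

section

variable {X : Type*}

/-- The values of a predicate on a list of functions, as a tree. -/
def encodePredicate (Fs : List (X → Bool)) (a : (X → Bool) → Bool) : Data := encodeBits (Fs.map a)

/-- A labelled point as a tree, given by the values of the functions in `Fs`. -/
def encodeExample (Fs : List (X → Bool)) (s : X × Bool) : Data :=
  .node (encodeValues s.1 Fs) (encodeBool s.2)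

/-- A list of labelled points as a tree. -/
def encodeExamples (Fs : List (X → Bool)) (S : List (X × Bool)) : Data :=
  encodeList (S.map (encodeExample Fs))

/-- A round of the learner as a tree. -/
def encodeRound (Fs : List (X → Bool)) (p : Round X) : Data :=
  .node (encodePredicate Fs p.1) (encodePredicate Fs p.2)

/-- A list of rounds as a tree. -/
def encodeRounds (Fs : List (X → Bool)) (H : List (Round X)) : Data :=
  encodeList (H.map (encodeRound Fs))

variable {Fs : List (X → Bool)} {S : List (X × Bool)}

theorem Prog.RunsWithin.within (x : X) (a : (X → Bool) → Bool) :
    Prog.subset.RunsWithin (.node (encodeValues x Fs) (encodePredicate Fs a))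
      (encodeBool (RobustLearning.within Fs a x)) (subsetTime Fs.length) :=
  RunsWithin.subset Fs (fun f => f x) a

/-- From a predicate and a sample, the disjunction of the predicate with `conflicts`. -/
def Prog.conflicts (v : Bool) : Prog :=
  .comp (.fold (.cond (.comp .snd last)
      (if v then .comp union (.pair (.comp .fst last) mid) else mid)
      (if v then mid else .comp union (.pair (.comp .fst last) mid))))
    (.triple .nil .fst .snd)

/-- A bound for the number of steps of `conflicts`. -/
def conflictsTime (N m : ℕ) : ℕ := foldTime (unionTime N + 20) m + 10

theorem foldl_conflicts (S : List (X × Bool)) (v : Bool) (a : (X → Bool) → Bool) :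
    S.foldl (fun a s => if s.2 = v then fun f => f s.1 || a f else a) a
      = fun f => conflicts S v f || a f := by
  induction S generalizing a with
  | nil => simp [conflicts]
  | cons s S ih =>
    rw [List.foldl_cons, ih]
    funext f
    by_cases h : s.2 = v
    · simp only [h, if_true, conflicts, List.any_cons, beq_self_eq_true, Bool.true_and]
      cases f s.1 <;> simp
    · have : (s.2 == v) = false := by simpa using h
      simp [h, conflicts, this]

theorem Prog.RunsWithin.conflicts (v : Bool) :
    (Prog.conflicts v).RunsWithin
      (.node (encodePredicate Fs fun _ => false) (encodeExamples Fs S))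
      (encodePredicate Fs (RobustLearning.conflicts S v)) (conflictsTime Fs.length S.length) := by
  have h := RunsWithin.fold (f := .cond (.comp .snd Prog.last)
      (if v then .comp Prog.union (.pair (.comp .fst Prog.last) Prog.mid) else Prog.mid)
      (if v then Prog.mid else .comp Prog.union (.pair (.comp .fst Prog.last) Prog.mid)))
    (encB := encodePredicate Fs) (encC := encodeExample Fs)
    (G := fun a s => if s.2 = v then fun f => f s.1 || a f else a) (fun _ => True) (e := .nil)
    (t := unionTime Fs.length + 20) S (fun a _ s _ => ⟨?_, trivial⟩) (b := fun _ => false) trivial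
  · refine ((RunsWithin.triple .nil .fst .snd).comp h).congr ?_ ?_
    · rw [foldl_conflicts]
      simp
    · unfold conflictsTime; omega
  · have hU : (Prog.comp Prog.union (.pair (.comp .fst Prog.last) Prog.mid)).RunsWithin
        (.node .nil (.node (encodePredicate Fs a) (encodeExample Fs s)))
        (encodePredicate Fs fun f => f s.1 || a f) (unionTime Fs.length + 10) :=
      ((RunsWithin.pair (RunsWithin.last.comp .fst) .mid).comp
        (RunsWithin.union Fs (fun f => f s.1) a)).mono (by omega)
    have hmid : Prog.mid.RunsWithin
        (.node .nil (.node (encodePredicate Fs a) (encodeExample Fs s)))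
        (encodePredicate Fs a) (unionTime Fs.length + 10) := RunsWithin.mid.mono (by omega)
    refine (RunsWithin.cond (p := s.2) (t := unionTime Fs.length + 10)
      (RunsWithin.last.comp .snd) (fun h => ?_) (fun h => ?_)).mono (by omega)
    · cases v <;> simpa [h]
    · cases v <;> simpa [h]

/-- From a round and a sample, the points left over by the round. -/
def Prog.remaining : Prog :=
  .comp (.fold (.cond
      (.cond (.comp subset (.pair (.comp .fst last) (.comp .fst .fst)))
        (.comp subset (.pair (.comp .fst last) (.comp .snd .fst))) .nil)
      (.pair last mid) mid))
    (.triple .fst .nil .snd)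

/-- A bound for the number of steps of `remaining`. -/
def remainingTime (N m : ℕ) : ℕ := foldTime (subsetTime N + subsetTime N + 50) m + 10

theorem foldl_filter {β : Type*} (p : β → Bool) (l acc : List β) :
    l.foldl (fun acc b => if p b then b :: acc else acc) acc = (l.filter p).reverse ++ acc := by
  induction l generalizing acc with
  | nil => simp
  | cons b l ih =>
    rw [List.foldl_cons, ih]
    cases h : p b <;> simp [h]

theorem Prog.RunsWithin.remaining (p : Round X) :
    Prog.remaining.RunsWithin (.node (encodeRound Fs p) (encodeExamples Fs S))
      (encodeExamples Fs (RobustLearning.remaining Fs p S))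
      (remainingTime Fs.length S.length) := by
  have h := RunsWithin.fold (f := .cond
      (.cond (.comp Prog.subset (.pair (.comp .fst Prog.last) (.comp .fst .fst)))
        (.comp Prog.subset (.pair (.comp .fst Prog.last) (.comp .snd .fst))) .nil)
      (.pair Prog.last Prog.mid) Prog.mid)
    (encB := encodeExamples Fs) (encC := encodeExample Fs)
    (G := fun acc s => if RobustLearning.within Fs p.1 s.1 && RobustLearning.within Fs p.2 s.1
      then s :: acc else acc) (fun _ => True) (e := encodeRound Fs p)
    (t := subsetTime Fs.length + subsetTime Fs.length + 50) S (fun a _ s _ => ⟨?_, trivial⟩)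
    (b := []) trivial
  · refine ((RunsWithin.triple .fst .nil .snd).comp h).congr ?_ ?_
    · rw [foldl_filter fun s : X × Bool =>
        RobustLearning.within Fs p.1 s.1 && RobustLearning.within Fs p.2 s.1, List.append_nil]
      rfl
    · unfold remainingTime; omega
  · refine (RunsWithin.cond
      (p := RobustLearning.within Fs p.1 s.1 && RobustLearning.within Fs p.2 s.1) (t := 7)
      (RunsWithin.cond (p := RobustLearning.within Fs p.1 s.1) (t := subsetTime Fs.length + 10)
        ((RunsWithin.pair (RunsWithin.last.comp .fst) (RunsWithin.fst.comp .fst)).comp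
          (RunsWithin.within s.1 p.1)) (fun h => ?_) (fun h => ?_)) (fun h => ?_)
      (fun h => ?_)).mono (by omega)
    · rw [h, Bool.true_and]
      exact ((RunsWithin.pair (RunsWithin.last.comp .fst) (RunsWithin.fst.comp .snd)).comp
          (RunsWithin.within s.1 p.2)).mono (by omega)
    · rw [h, Bool.false_and]
      exact RunsWithin.nil.mono (by omega)
    · rw [h, if_pos rfl]
      exact RunsWithin.pair .last .mid
    · rw [h, if_neg (by simp)]
      exact RunsWithin.mid.mono (by omega)

/-- One step of the learner. -/
def Prog.learnStep : Prog :=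
  .comp (.pair (.comp remaining (.pair .fst mid)) (.pair .fst last))
    (.pair (.pair (.comp (conflicts false) (.pair .fst (.comp .fst mid)))
      (.comp (conflicts true) (.pair .fst (.comp .fst mid)))) mid)

/-- A bound for the number of steps of `learnStep`. -/
def learnStepTime (N m : ℕ) : ℕ :=
  conflictsTime N m + conflictsTime N m + remainingTime N m + 60

/-- A state of the learner as a tree. -/
def encodeState (Fs : List (X → Bool)) (st : List (X × Bool) × List (Round X)) : Data :=
  .node (encodeExamples Fs st.1) (encodeRounds Fs st.2)

/-- The environment supplies the all-false predicate from which `conflicts` starts. The list element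
`d` is ignored: the list only counts rounds. -/
theorem Prog.RunsWithin.learnStep (st : List (X × Bool) × List (Round X)) (d : Data) :
    Prog.learnStep.RunsWithin
      (.node (encodePredicate Fs fun _ => false) (.node (encodeState Fs st) d))
      (encodeState Fs (RobustLearning.learnStep Fs st))
      (learnStepTime Fs.length st.1.length) := by
  have hc : ∀ v, (Prog.comp (.conflicts v) (.pair .fst (.comp .fst Prog.mid))).RunsWithin
      (.node (encodePredicate Fs fun _ => false) (.node (encodeState Fs st) d))
      (encodePredicate Fs (RobustLearning.conflicts st.1 v))
      (1 + (3 + 1 + 1) + 1 + conflictsTime Fs.length st.1.length + 1) := fun v =>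
    (RunsWithin.pair .fst (RunsWithin.mid.comp .fst)).comp (RunsWithin.conflicts v)
  exact ((((hc false).pair (hc true)).pair .mid).comp
    (((RunsWithin.pair .fst .mid).comp (RunsWithin.remaining (roundOf st.1))).pair
      (RunsWithin.pair .fst .last))).mono (by unfold learnStepTime; omega)

/-- From a sample, the rounds of the learner. -/
def Prog.learn : Prog :=
  .comp .snd (.comp (.fold learnStep) (.triple (.comp zeros (.comp .fst .fst))
    (.pair .skip .nil) (.comp .fst .fst)))

/-- A bound for the number of steps of `learn`. -/
def learnTime (N m : ℕ) : ℕ := foldTime (learnStepTime N m) N + foldTime 5 N + 40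

theorem learnStepTime_mono {N m m' : ℕ} (h : m ≤ m') :
    learnStepTime N m ≤ learnStepTime N m' := by
  unfold learnStepTime conflictsTime remainingTime foldTime
  gcongr

theorem Prog.RunsWithin.learn (S : List (X × Bool)) :
    Prog.learn.RunsWithin (encodeExamples Fs S) (encodeRounds Fs (RobustLearning.learn Fs S))
      (learnTime Fs.length S.length) := by
  -- The program does not know `n`. It takes the feature values at the first example as round
  -- counter, and reads the empty list if there is no example; hence the case `S = []` in `learn`.
  suffices h : ∀ l : List Bool, (encodeExamples Fs S).left.left = encodeBits l →
      l.length = (if S = [] then 0 else Fs.length) →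
      (l ≠ [] → encodeBits (l.map fun _ => false) = encodePredicate Fs fun _ => false) →
      Prog.learn.RunsWithin (encodeExamples Fs S) (encodeRounds Fs (RobustLearning.learn Fs S))
        (learnTime Fs.length S.length) by
    cases S with
    | nil => exact h [] rfl rfl (by simp)
    | cons s S =>
      refine h (Fs.map fun f => f s.1) rfl (by simp) fun _ => ?_
      simp [encodePredicate, Function.comp_def]
  intro l hl hlen hzero
  -- The invariant says that the remaining sample never grows, so the cost of a step on `S` bounds
  -- every round.
  have hfold := RunsWithin.fold (f := Prog.learnStep) (encB := encodeState Fs)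
    (encC := encodeBool) (G := fun st _ => RobustLearning.learnStep Fs st)
    (fun st => st.1.length ≤ S.length) (e := encodeBits (l.map fun _ => false))
    (t := learnStepTime Fs.length S.length) l (fun st hst b hb => ⟨?_, ?_⟩) (b := (S, []))
    le_rfl
  · rw [List.foldl_const] at hfold
    have hstart : (Prog.triple (.comp .zeros (.comp .fst .fst)) (.pair .skip .nil)
        (.comp .fst .fst)).RunsWithin (encodeExamples Fs S)
        (.node (encodeBits (l.map fun _ => false)) (.node (encodeState Fs (S, []))
          (encodeBits l))) (foldTime 5 l.length + 20) :=
      (RunsWithin.triple (((RunsWithin.fst.comp .fst).congr hl le_rfl).comp (.zeros l))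
        (RunsWithin.pair .skip .nil) ((RunsWithin.fst.comp .fst).congr hl le_rfl)).mono (by omega)
    have hlen' : l.length ≤ Fs.length := by rw [hlen]; split_ifs <;> simp
    have h1 := foldTime_mono (le_refl 5) hlen'
    have h2 := foldTime_mono (le_refl (learnStepTime Fs.length S.length)) hlen'
    refine ((hstart.comp hfold).comp .snd).congr (by rw [hlen]; rfl) ?_
    unfold learnTime
    omega
  · rw [hzero (List.ne_nil_of_mem hb)]
    exact (RunsWithin.learnStep st _).mono (learnStepTime_mono hst)
  · change (RobustLearning.remaining Fs _ st.1).length ≤ _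
    unfold RobustLearning.remaining
    rw [List.length_reverse]
    exact (List.length_filter_le _ _).trans hst

/-- From the list of the values of the features at a point, and a list of rounds: the value of the
hypothesis. -/
def Prog.hypothesis : Prog :=
  .comp (.fold (.cond (.comp subset (.pair .fst (.comp .fst last)))
      (.cond (.comp subset (.pair .fst (.comp .snd last))) mid .nil) tt))
    (.triple .fst .nil .snd)

/-- A bound for the number of steps of `hypothesis`. -/
def hypothesisTime (N r : ℕ) : ℕ := foldTime (subsetTime N + subsetTime N + 50) r + 10

theorem Prog.RunsWithin.hypothesis (x : X) (H : List (Round X)) :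
    Prog.hypothesis.RunsWithin (.node (encodeValues x Fs) (encodeRounds Fs H))
      (encodeBool (RobustLearning.hypothesis Fs H x)) (hypothesisTime Fs.length H.length) := by
  have h := RunsWithin.fold (f := .cond (.comp Prog.subset (.pair .fst (.comp .fst Prog.last)))
      (.cond (.comp Prog.subset (.pair .fst (.comp .snd Prog.last))) Prog.mid .nil) Prog.tt)
    (encB := encodeBool) (encC := encodeRound Fs) (G := override Fs x) (fun _ => True)
    (e := encodeValues x Fs) (t := subsetTime Fs.length + subsetTime Fs.length + 50) H
    (fun b _ p _ => ⟨?_, trivial⟩) (b := false) trivial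
  · exact ((RunsWithin.triple .fst .nil .snd).comp h).mono (by unfold hypothesisTime; omega)
  · refine (RunsWithin.cond (p := RobustLearning.within Fs p.1 x)
      (t := subsetTime Fs.length + 30)
      ((RunsWithin.pair .fst (RunsWithin.last.comp .fst)).comp (RunsWithin.within x p.1))
      (fun h => ?_) (fun h => ?_)).mono (by omega)
    · unfold override
      rw [if_pos h]
      refine (RunsWithin.cond (p := RobustLearning.within Fs p.2 x) (t := 3)
        ((RunsWithin.pair .fst (RunsWithin.last.comp .snd)).comp (RunsWithin.within x p.2))
        (fun h => ?_) (fun h => ?_)).mono (by omega)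
      · rw [if_pos h]; exact RunsWithin.mid
      · rw [if_neg (by simp [h])]; exact RunsWithin.nil.mono (by omega)
    · unfold override
      rw [if_neg (by simp [h])]
      exact RunsWithin.tt.mono (by omega)

end

/-! ### The complete learner and evaluator -/

/-- From a labelled sample, the values of the features at its points, with the labels. -/
def Prog.featureSample (k : ℕ) : Prog :=
  .comp (.fold (.pair (.pair (.comp (features k) (.comp .fst last)) (.comp .snd last)) mid))
    (.triple .nil .nil .skip)

/-- A bound for the number of steps of `featureSample k`. -/
def featureSampleTime (n k m : ℕ) : ℕ := foldTime (featuresTime n k + 30) m + 10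

/-- The sample comes out reversed because the fold conses; consistency depends only on membership,
so this is harmless. -/
theorem Prog.RunsWithin.featureSample {n m : ℕ} (k : ℕ) (S : Fin m → Cube n × Bool) :
    (Prog.featureSample k).RunsWithin (encodeSample S)
      (encodeExamples (RobustLearning.features n k) (List.ofFn S).reverse)
      (featureSampleTime n k m) := by
  have h := RunsWithin.fold
    (f := .pair (.pair (.comp (.features k) (.comp .fst Prog.last)) (.comp .snd Prog.last))
      Prog.mid)
    (encB := encodeExamples (RobustLearning.features n k))
    (encC := fun s : Cube n × Bool => .node (encodeCube s.1) (encodeBool s.2))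
    (G := fun acc s => s :: acc) (fun _ => True) (e := .nil) (t := featuresTime n k + 30)
    (List.ofFn S) (fun acc _ s _ => ⟨?_, trivial⟩) (b := []) trivial
  · refine ((RunsWithin.triple (x := encodeSample S) .nil .nil .skip).comp
      (g := .fold (.pair (.pair (.comp (.features k) (.comp .fst Prog.last))
        (.comp .snd Prog.last)) Prog.mid)) (z := encodeExamples (RobustLearning.features n k)
          (List.ofFn S).reverse) (t := foldTime (featuresTime n k + 30) m) ?_).mono
        (by unfold featureSampleTime; omega)
    rw [List.map_ofFn, List.length_ofFn, foldl_cons_map (fun s => s), List.append_nil,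
      List.map_id'] at h
    exact h
  · exact (((RunsWithin.last.comp .fst).comp (RunsWithin.features k s.1)).pair
      (RunsWithin.last.comp .snd) |>.pair .mid).mono (by omega)

/-- The learning algorithm for `k`-decision lists. -/
def Prog.learner (k : ℕ) : Prog := .comp learn (featureSample k)

/-- A bound for the number of steps of `learner k`. -/
def learnerTime (k n m : ℕ) : ℕ := featureSampleTime n k m + learnTime ((2 * n + 1) ^ k) m + 1

/-- The evaluation algorithm for the hypotheses of `learner k`. -/
def Prog.evaluator (k : ℕ) : Prog := .comp hypothesis (.pair (.comp (features k) .snd) .fst)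

/-- A bound for the number of steps of `evaluator k`. -/
def evaluatorTime (k n : ℕ) : ℕ :=
  featuresTime n k + hypothesisTime ((2 * n + 1) ^ k) ((2 * n + 1) ^ k) + 10

/-- The hypothesis that `learner k` outputs on a sample. -/
def learnedHypothesis (k : ℕ) {n m : ℕ} (S : Fin m → Cube n × Bool) : Cube n → Bool :=
  hypothesis (features n k) (learn (features n k) (List.ofFn S).reverse)

theorem outputs_learnedHypothesis (k : ℕ) {n m : ℕ} (S : Fin m → Cube n × Bool) :
    Outputs (.learner k) (.evaluator k) S (learnedHypothesis k S) (learnerTime k n m)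
      (evaluatorTime k n) := by
  refine ⟨encodeRounds (features n k) (learn (features n k) (List.ofFn S).reverse), ?_,
    fun x => ?_⟩
  · refine ((RunsWithin.featureSample k S).comp (RunsWithin.learn _)).mono ?_
    rw [length_features, List.length_reverse, List.length_ofFn]
    rfl
  · refine (((RunsWithin.snd.comp (RunsWithin.features k x)).pair .fst).comp
      (RunsWithin.hypothesis x _)).mono ?_
    have h : hypothesisTime (features n k).length
        (learn (features n k) (List.ofFn S).reverse).length
        ≤ hypothesisTime ((2 * n + 1) ^ k) ((2 * n + 1) ^ k) := by
      rw [length_features]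
      unfold hypothesisTime
      gcongr
      exact foldTime_mono le_rfl ((length_learn_le _ _).trans (length_features n k).le)
    unfold evaluatorTime
    omega

/-! ### Polynomial bounds -/

section

variable {V : Type*} {R : Subsemiring (V → ℕ)} {n m : V → ℕ}

/-- Time bounds are built by sums and products from constants and their arguments, so they stay in
any subsemiring `R` of functions containing the arguments. With the functions given by polynomials
as `R`, polynomials are obtained without being written out. -/
theorem foldTime_mem {t l : V → ℕ} (ht : t ∈ R) (hl : l ∈ R) :
    (fun v => foldTime (t v) (l v)) ∈ R :=
  add_mem (mul_mem (add_mem ht (ofNat_mem R 24)) hl) (ofNat_mem R 8)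

theorem featureCount_mem (k : ℕ) (hn : n ∈ R) : (fun v => (2 * n v + 1) ^ k) ∈ R :=
  pow_mem (add_mem (mul_mem (ofNat_mem R 2) hn) (one_mem R)) k

theorem featuresTime_mem (k : ℕ) (hn : n ∈ R) : (fun v => featuresTime (n v) k) ∈ R := by
  have hM : (fun v => 2 * n v + 1) ∈ R := add_mem (mul_mem (ofNat_mem R 2) hn) (one_mem R)
  have h20 : (fun _ => 20 : V → ℕ) ∈ R := ofNat_mem R 20
  have hP : (fun v => productsTime (2 * n v + 1) ((2 * n v + 1) ^ k)) ∈ R :=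
    add_mem (foldTime_mem (add_mem (foldTime_mem h20 (featureCount_mem k hn)) h20) hM)
      (ofNat_mem R 10)
  exact add_mem (add_mem (mul_mem (natCast_mem R k) (add_mem hP (ofNat_mem R 3)))
    (foldTime_mem h20 hn)) h20

theorem subsetTime_mem (hn : n ∈ R) : (fun v => subsetTime (n v)) ∈ R :=
  add_mem (foldTime_mem (ofNat_mem R 40) hn) (ofNat_mem R 20)

theorem unionTime_mem (hn : n ∈ R) : (fun v => unionTime (n v)) ∈ R :=
  add_mem (add_mem (foldTime_mem (ofNat_mem R 40) hn) (foldTime_mem (ofNat_mem R 7) hn))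
    (ofNat_mem R 40)

theorem hypothesisTime_mem (hn : n ∈ R) (hm : m ∈ R) :
    (fun v => hypothesisTime (n v) (m v)) ∈ R :=
  add_mem (foldTime_mem (add_mem (add_mem (subsetTime_mem hn) (subsetTime_mem hn))
    (ofNat_mem R 50)) hm) (ofNat_mem R 10)

theorem learnTime_mem (hn : n ∈ R) (hm : m ∈ R) : (fun v => learnTime (n v) (m v)) ∈ R := by
  have hc : (fun v => conflictsTime (n v) (m v)) ∈ R :=
    add_mem (foldTime_mem (add_mem (unionTime_mem hn) (ofNat_mem R 20)) hm) (ofNat_mem R 10)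
  -- `remainingTime` and `hypothesisTime` are given by the same expression.
  have hr : (fun v => remainingTime (n v) (m v)) ∈ R := hypothesisTime_mem hn hm
  have hs : (fun v => learnStepTime (n v) (m v)) ∈ R :=
    add_mem (add_mem (add_mem hc hc) hr) (ofNat_mem R 60)
  exact add_mem (add_mem (foldTime_mem hs hn) (foldTime_mem (ofNat_mem R 5) hn)) (ofNat_mem R 40)

theorem learnerTime_mem (k : ℕ) (hn : n ∈ R) (hm : m ∈ R) :
    (fun v => learnerTime k (n v) (m v)) ∈ R :=
  add_mem (add_mem (add_mem (foldTime_mem (add_mem (featuresTime_mem k hn) (ofNat_mem R 30)) hm)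
    (ofNat_mem R 10)) (learnTime_mem (featureCount_mem k hn) hm)) (one_mem R)

theorem evaluatorTime_mem (k : ℕ) (hn : n ∈ R) : (fun v => evaluatorTime k (n v)) ∈ R :=
  add_mem (add_mem (featuresTime_mem k hn)
    (hypothesisTime_mem (featureCount_mem k hn) (featureCount_mem k hn))) (ofNat_mem R 10)

end

theorem exists_polynomial_learnerTime (k : ℕ) :
    ∃ p : MvPolynomial (Fin 2) ℕ, ∀ n m, MvPolynomial.eval ![n, m] p = learnerTime k n m := by
  have hX : ∀ i, (fun v : Fin 2 → ℕ => v i)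
      ∈ (RingHom.pi fun v : Fin 2 → ℕ => MvPolynomial.eval v).rangeS := fun i =>
    ⟨MvPolynomial.X i, funext fun v => MvPolynomial.eval_X (f := v) i⟩
  obtain ⟨p, hp⟩ := learnerTime_mem k (hX 0) (hX 1)
  exact ⟨p, fun n m => congrFun hp ![n, m]⟩

theorem exists_polynomial_evaluatorTime (k : ℕ) :
    ∃ p : Polynomial ℕ, ∀ n, p.eval n = evaluatorTime k n := by
  have hX : (fun n : ℕ => n) ∈ (RingHom.pi fun n : ℕ => Polynomial.evalRingHom n).rangeS :=
    ⟨Polynomial.X, funext fun n => Polynomial.eval_X (x := n)⟩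
  obtain ⟨p, hp⟩ := evaluatorTime_mem k hX
  exact ⟨p, fun n => congrFun hp n⟩

/-! ### Assembly of the theorem -/

/-- The learner outputs a consistent first-match list of features. -/
theorem exists_firstMatch_learnedHypothesis {k n m : ℕ} (c : DecisionList k n)
    (xs : Fin m → Cube n) :
    ∃ I, I.Sublist (allRounds (features n k) ((2 * n + 1) ^ k)) ∧
      learnedHypothesis k (labelled c.eval xs) = firstMatch I ∧
      ∀ j, learnedHypothesis k (labelled c.eval xs) (xs j) = c.eval (xs j) := by
  obtain ⟨I, hI, h⟩ := exists_firstMatch_eq (Fs := features n k)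
    (learn (features n k) (List.ofFn (labelled c.eval xs)).reverse)
    ((length_learn_le _ _).trans (length_features n k).le)
  refine ⟨I, hI, h, fun j => ?_⟩
  refine hypothesis_learn (J := c.items.map fun p => (p.1.eval, p.2)) ?_ ?_ ?_
    (s := (xs j, c.eval (xs j))) ?_
  · simp only [List.mem_map]
    rintro _ ⟨p, -, rfl⟩
    exact p.1.eval_mem_features
  -- The always true test is the last item of the decision list.
  · refine ⟨_, List.mem_map_of_mem (List.getLast_mem c.items_ne), fun x => ?_⟩
    simp [Term.eval, c.last_true]
  · intro s hs
    rw [List.mem_reverse, List.mem_ofFn] at hs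
    obtain ⟨i, rfl⟩ := hs
    rw [← c.eval_eq_firstMatch]
    rfl
  · rw [List.mem_reverse, List.mem_ofFn]
    exact ⟨j, rfl⟩

/-- `k`-decision lists are efficiently `log₂ n`-robustly learnable. -/
theorem efficientlyRobustlyLearnable_kDL (k : ℕ) (α : ℝ) (hα : 0 < α) :
    EfficientlyRobustlyLearnable (fun n => Nat.log 2 n) (kDL k)
      (fun _ => {D | IsLogLipschitz α D}) := by
  obtain ⟨time, htime⟩ := exists_polynomial_learnerTime k
  obtain ⟨evalTime, hevalTime⟩ := exists_polynomial_evaluatorTime k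
  obtain ⟨C, hC⟩ := exists_sample_bound α hα k
  -- The variables stand for `n`, `1 / ε`, `1 / δ` and the size of `c`. `N` is the number of
  -- features, and `W` the length of `allRounds` for `N` rounds.
  let N : MvPolynomial (Fin 4) ℝ := (2 * .X 0 + 1) ^ k
  let W : MvPolynomial (Fin 4) ℝ := N * (2 * N)
  refine ⟨.learner k, .evaluator k,
    (2 * ((.X 0 + 1) * ((W + 1) * (.X 3 + 1)) * (1 + .X 1) + 1)) ^ C * (W + .X 2), time, evalTime,
    fun _ _ S => learnedHypothesis k S, fun n m c xs => ?_, ?_⟩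
  · rw [htime, hevalTime]
    exact outputs_learnedHypothesis k _
  · intro n c D hD ε δ hε hδ m hm
    refine hC n c D hD (allRounds (features n k) ((2 * n + 1) ^ k))
      (fun p hp => exists_term_of_mem_features (mem_allRounds hp)) m
      (fun xs => learnedHypothesis k (labelled c.eval xs))
      (exists_firstMatch_learnedHypothesis c) ε δ hε hδ ?_
    rw [length_allRounds, length_features]
    simpa [N, W, kDL] using hm

end RobustLearning

theorem corollary2 (k : ℕ) (α : ℝ) (hα : 0 < α) :
    RobustLearning.EfficientlyRobustlyLearnable (fun n => Nat.log 2 n) (RobustLearning.kDL k)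
      (fun _ => {D | RobustLearning.IsLogLipschitz α D}) :=
  RobustLearning.efficientlyRobustlyLearnable_kDL k α hα
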